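/- Let $d\ge 1$. A (solid, not necessarily convex) simplicial polytope in $\mathbb{R}^d$ is a nonempty compact set $P\subset\mathbb{R}^d$ that is the closure of its interior, together with a finite geometric simplicial complex, pure of dimension $d-1$, whose underlying space is the topological boundary of $P$; the $(d-1)$-simplices of this complex are the facets of $P$. (A full-dimensional convex polytope all of whose facets are simplices is an example.) Orient the facets as the boundary of $P$, so that they form a $(d-1)$-dimensional simplicial chain $\mathcal{C}$. A filling of $\mathcal{C}$ is a $d$-dimensional simplicial chain $\mathcal{K}=\sum_i k_i\Delta_i$ with integer coefficients $k_i$ and nondegenerate oriented simplices $\Delta_i\subset\mathbb{R}^d$ such that $\partial\mathcal{K}=\mathcal{C}$. With $\mathrm{Vol}$ the signed volume and $\mathbf{o}_i$ the circumcenter of $\Delta_i$, put $\mathrm{Vol}(\mathcal{K})=\sum_i k_i\mathrm{Vol}(\Delta_i)$; the circumcenter of mass of $\mathcal{K}$ is $\frac{1}{\mathrm{Vol}(\mathcal{K})}\sum_i k_i\mathrm{Vol}(\Delta_i)\,\mathbf{o}_i$, and the circumcenter of mass of $P$ is that of any filling of $\mathcal{C}$. **Theorem.** Let $P$ be a simplicial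 polytope in $\mathbb{R}^d$ such that, for some constant $c$, the sum of the squares of the edge lengths of every facet of $P$ equals $c$. Then the circumcenter of mass of $P$ coincides with the centroid $\mathbf{m}=\frac{1}{\mathrm{Vol}(P)}\int_P \mathbf{x}\,d\mathbf{x}$ of the solid polytope $P$; that is, $\mathcal{C}$ has a filling, and every filling $\mathcal{K}$ of $\mathcal{C}$ has $\mathrm{Vol}(\mathcal{K})\ne 0$ and circumcenter of mass $\mathbf{m}$. -/

import Mathlib

open Set Filter Topology MeasureTheory

noncomputable section

/-- A (solid, not necessarily convex) simplicial polytope in `ℝ^d`: a nonempty compact set that is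
the closure of its interior, together with a finite geometric simplicial complex, pure of
dimension `d - 1`, whose underlying space is the topological boundary of the set. A full-dimensional
convex polytope all of whose proper faces are simplices is the special case in which the set is
convex and the complex is its boundary complex. -/
structure SimplicialPolytope (d : ℕ) where
  /-- the solid polytope -/
  carrier : Set (EuclideanSpace ℝ (Fin d))
  /-- the boundary complex; a face is recorded as its finite set of vertices -/
  boundary : Geometry.SimplicialComplex ℝ (EuclideanSpace ℝ (Fin d))
  nonempty : carrier.Nonempty
  isCompact : IsCompact carrier
  closure_interior : closure (interior carrier) = carrier
  finite_faces : boundary.faces.Finite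
  card_of_facet : ∀ t ∈ boundary.facets, t.card = d
  space_boundary : boundary.space = frontier carrier

/-- The sum of the squares of the edge lengths of the simplex with vertex set `t`. The ordered pairs
of distinct vertices count every edge twice. -/
def edgeSqSum {d : ℕ} (t : Finset (EuclideanSpace ℝ (Fin d))) : ℝ :=
  (∑ p ∈ t.offDiag, dist p.1 p.2 ^ 2) / 2

/-- The signed volume of the ordered simplex `(w 0, …, w d)` in `ℝ^d`:
`det (w 1 - w 0, …, w d - w 0) / d!`. -/
def signedVolume {d : ℕ} (w : Fin (d + 1) → EuclideanSpace ℝ (Fin d)) : ℝ :=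
  (Matrix.of fun i j : Fin d => w i.succ j - w 0 j).det / (d.factorial : ℝ)

/-- A `d`-dimensional simplicial chain in `ℝ^d`: a formal integral combination of nondegenerate
simplices with ordered vertices. -/
abbrev SimplicialChain (d : ℕ) :=
  Affine.Simplex ℝ (EuclideanSpace ℝ (Fin d)) d →₀ ℤ

namespace SimplicialChain

variable {d : ℕ}

open Classical in
/-- The coefficient of the oriented `(d - 1)`-simplex `[v 0, …, v (d - 1)]` in the boundary
`∂ K = ∑ K(s) ∑ i, (-1)^i [s 0, …, s (i - 1), s (i + 1), …, s d]`. Orderings that differ by a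
permutation `σ` represent the same oriented simplex up to the factor `sign σ`. -/
def boundaryCoeff (K : SimplicialChain d) (v : Fin d → EuclideanSpace ℝ (Fin d)) : ℤ :=
  K.sum fun s k => k * ∑ i : Fin (d + 1), (-1) ^ (i : ℕ) *
    ∑ σ : Equiv.Perm (Fin d),
      if (fun j => s.points (i.succAbove (σ j))) = v then (Equiv.Perm.sign σ : ℤ) else 0

/-- The total signed volume of a chain. -/
def volume (K : SimplicialChain d) : ℝ :=
  K.sum fun s k => (k : ℝ) * signedVolume s.points

/-- The circumcenter of mass of a chain: the center of mass of the circumcenters of its simplices,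
weighted by the signed volumes. It is meaningful when the total volume is not zero. -/
def circumcenterOfMass (K : SimplicialChain d) : EuclideanSpace ℝ (Fin d) :=
  K.volume⁻¹ • K.sum fun s k => ((k : ℝ) * signedVolume s.points) • s.circumcenter

end SimplicialChain

namespace SimplicialPolytope

variable {d : ℕ}

/-- The points on the inner side of the facet `t`: moving from any relative interior point of the
facet towards such a point, one first enters the interior of the polytope. -/
def innerSide (P : SimplicialPolytope d) (t : Finset (EuclideanSpace ℝ (Fin d))) :
    Set (EuclideanSpace ℝ (Fin d)) :=
  {p | ∀ x ∈ intrinsicInterior ℝ (convexHull ℝ (t : Set (EuclideanSpace ℝ (Fin d)))),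
    ∀ᶠ ε in 𝓝[>] (0 : ℝ), AffineMap.lineMap x p ε ∈ interior P.carrier}

open Classical in
/-- The coefficient of the oriented simplex `[v 0, …, v (d - 1)]` in the boundary cycle of the
polytope, each facet being oriented as part of the boundary: `v` is a positive ordering of the
vertices of a facet when `(p, v 0, …, v (d - 1))` is a positive simplex for `p` on the inner
side of the facet. -/
def cycleCoeff (P : SimplicialPolytope d) (v : Fin d → EuclideanSpace ℝ (Fin d)) : ℤ :=
  if Finset.univ.image v ∈ P.boundary.facets then
    if ∃ p ∈ P.innerSide (Finset.univ.image v), 0 < signedVolume (Fin.cons p v) then 1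
    else if ∃ p ∈ P.innerSide (Finset.univ.image v), signedVolume (Fin.cons p v) < 0 then -1
    else 0
  else 0

/-- The chain `K` is a filling of the boundary cycle of the polytope: `∂ K` is that cycle. -/
def IsFilling (P : SimplicialPolytope d) (K : SimplicialChain d) : Prop :=
  ∀ v : Fin d → EuclideanSpace ℝ (Fin d), K.boundaryCoeff v = P.cycleCoeff v

/-- The point `x` is the circumcenter of mass of the polytope, that is, of any filling of its
boundary cycle: fillings exist, all have nonzero volume, and `x` is the circumcenter of mass of
every one of them. -/
def IsCircumcenterOfMass (P : SimplicialPolytope d) (x : EuclideanSpace ℝ (Fin d)) : Prop :=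
  (∃ K : SimplicialChain d, P.IsFilling K) ∧
    ∀ K : SimplicialChain d, P.IsFilling K → K.volume ≠ 0 ∧ K.circumcenterOfMass = x

/-- The centroid of the solid polytope. -/
def centroid (P : SimplicialPolytope d) : EuclideanSpace ℝ (Fin d) :=
  ⨍ x in P.carrier, x ∂(MeasureTheory.volume)

end SimplicialPolytope

end

/-! The proof has an algebraic half, valid for every chain, and a geometric half about the solid
polytope.

Algebra. Pairing a chain with the coboundary of an alternating function `q` of ordered `(d -
1)`-simplices uses only the boundary of the chain (`SimplicialChain.sum_faceSum_eq`). Three choices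
of `q` matter. The coordinate determinant has the homogeneous determinant, `d!` times the signed
volume, as coboundary. Its product with the sum of the `j`-th coordinates of the vertices has as
coboundary that determinant times the vertex sum. So total volume and first moment depend only on
the boundary. The product of the squared edge sum with a component of the facet normal has as
coboundary, up to a factor, the volume times the displacement from centroid to circumcenter
(`faceSum_pairSqSum_mul_normalDet`): all vertices lie on one sphere, so the squared edge sum of the
face opposite a vertex is an affine function of that vertex. If the edge sum is a constant `c` on
the boundary, this third pairing equals `c` times the total normal of closed surfaces, which is
zero. Hence the volume-weighted sums of circumcenters and of centroids agree
(`SimplicialChain.sum_circumcenter_eq`).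

Geometry. It remains to find one filling whose volume and first moment are those of the solid, up to
normalization. The cone from a generic apex `p` over the facets, signed by whether `p` is on the
inner side, serves. Along a generic ray from `p`, membership in the polytope changes exactly when a
facet is crossed, by the sign of that facet (`SimplicialPolytope.sum_faceSign_hit`). Read at almost
every point, this says that the signed indicators of the cones add up to the indicator of the
polytope, which gives the integrals (`SimplicialPolytope.setIntegral_carrier`). Read for two rays on
either side of a ridge, it says that the side faces of the cones cancel
(`SimplicialPolytope.IsGenericApex.sum_faceSign_ridge`), so the cone is a filling
(`SimplicialPolytope.isFilling_coneChain`). -/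

/-- The `d`-dimensional Euclidean space. -/
abbrev Pt (d : ℕ) := EuclideanSpace ℝ (Fin d)

variable {d : ℕ}

/-! ### Signed volume as a determinant of homogeneous coordinates. -/

/-- Homogeneous coordinates of a point. -/
def homog (x : Pt d) : Fin (d + 1) → ℝ := Fin.cons 1 fun i => x i

/-- The determinant of the homogeneous coordinates of `d + 1` points. -/
def homogDet (w : Fin (d + 1) → Pt d) : ℝ := Matrix.detRowAlternating fun i => homog (w i)

theorem signedVolume_eq (w : Fin (d + 1) → Pt d) :
    signedVolume w = homogDet w / (d.factorial : ℝ) := by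
  unfold signedVolume homogDet
  congr 1
  -- Subtracting the first row from all others leaves a single nonzero entry in the column of ones.
  let B : Matrix (Fin (d + 1)) (Fin (d + 1)) ℝ :=
    fun i j => homog (w i) j - (if i = 0 then 0 else 1) * homog (w 0) j
  have h : Matrix.det (fun i => homog (w i)) = B.det := by
    refine Matrix.det_eq_of_forall_row_eq_smul_add_const (fun i => if i = 0 then 0 else 1) 0
      (by simp) fun i j => ?_
    simp [B]
  change _ = Matrix.det (fun i => homog (w i))
  rw [h, Matrix.det_succ_column_zero, Fin.sum_univ_succ, Finset.sum_eq_zero]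
  · simp only [B, homog]
    simp
    congr 1
  · intro i _
    simp [B, homog]

theorem homogDet_perm (w : Fin (d + 1) → Pt d) (σ : Equiv.Perm (Fin (d + 1))) :
    homogDet (w ∘ σ) = (Equiv.Perm.sign σ : ℤ) * homogDet w := by
  have := Matrix.detRowAlternating.map_perm (fun i => homog (w i)) σ
  unfold homogDet
  rw [Units.smul_def, ← Int.cast_smul_eq_zsmul ℝ] at this
  exact this

theorem signedVolume_perm (w : Fin (d + 1) → Pt d) (σ : Equiv.Perm (Fin (d + 1))) :
    signedVolume (w ∘ σ) = (Equiv.Perm.sign σ : ℤ) * signedVolume w := by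
  rw [signedVolume_eq, signedVolume_eq, homogDet_perm, mul_div_assoc]

/-- Moving the `i`-th vertex to the front is a cycle of sign `(-1) ^ i`. This matches the sign of
the `i`-th face in the boundary formula with the orientation induced from the opposite vertex. -/
theorem signedVolume_cons_succAbove (w : Fin (d + 1) → Pt d) (i : Fin (d + 1)) :
    signedVolume (Fin.cons (w i) fun j => w (i.succAbove j)) =
      (-1) ^ (i : ℕ) * signedVolume w := by
  have : (Fin.cons (w i) fun j => w (i.succAbove j)) ∘ (i.cycleRange : Equiv.Perm _) = w := by
    rw [Fin.cons_comp_cycleRange]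
    exact Fin.insertNth_self_removeNth i w
  have h := signedVolume_perm (Fin.cons (w i) fun j => w (i.succAbove j)) i.cycleRange
  rw [this, Fin.sign_cycleRange] at h
  rw [h, ← mul_assoc]
  push_cast
  rw [← mul_pow]
  simp

theorem signedVolume_cons_perm (y : Pt d) (v : Fin d → Pt d) (σ : Equiv.Perm (Fin d)) :
    signedVolume (Fin.cons y (v ∘ σ)) =
      (Equiv.Perm.sign σ : ℤ) * signedVolume (Fin.cons y v) := by
  have h := signedVolume_perm (Fin.cons y v) (Equiv.Perm.decomposeFin.symm (0, σ))
  rw [Equiv.Perm.decomposeFin.symm_sign] at h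
  simp only [↓reduceIte, one_mul] at h
  rw [← h]
  congr 1
  funext i
  refine Fin.cases ?_ (fun j => ?_) i <;> simp

theorem signedVolume_eq_zero_of_eq {w : Fin (d + 1) → Pt d} {i j : Fin (d + 1)}
    (h : w i = w j) (hij : i ≠ j) : signedVolume w = 0 := by
  rw [signedVolume_eq, homogDet,
    Matrix.detRowAlternating.map_eq_zero_of_eq _ (i := i) (j := j) (by simp [h]) hij, zero_div]

theorem exists_affineMap_signedVolume (v : Fin d → Pt d) :
    ∃ L : Pt d →ᵃ[ℝ] ℝ, ∀ y, L y = signedVolume (Fin.cons y v) := by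
  let l : Pt d →ₗ[ℝ] (Fin (d + 1) → ℝ) :=
    { toFun := fun x => Fin.cons 0 fun i => x i
      map_add' := fun x y => by ext i; refine Fin.cases ?_ (fun j => ?_) i <;> simp
      map_smul' := fun a x => by ext i; refine Fin.cases ?_ (fun j => ?_) i <;> simp }
  have hl : ∀ x, homog x = homog 0 + l x := fun x => by
    ext i; refine Fin.cases ?_ (fun j => ?_) i <;> simp [homog, l]
  let D : (Fin (d + 1) → ℝ) →ₗ[ℝ] ℝ :=
    (Matrix.detRowAlternating (n := Fin (d + 1)) (R := ℝ)).toMultilinearMap.toLinearMap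
      (Fin.cons (homog 0) fun i => homog (v i)) 0
  have hD : ∀ y, homogDet (Fin.cons y v) = D (homog 0) + D (l y) := by
    intro y
    rw [← map_add, ← hl]
    simp only [D, MultilinearMap.toLinearMap_apply]
    rw [Fin.update_cons_zero]
    unfold homogDet
    refine congrArg Matrix.detRowAlternating (funext fun i => ?_)
    refine Fin.cases ?_ (fun j => ?_) i <;> simp
  refine ⟨((d.factorial : ℝ)⁻¹ • (D ∘ₗ l)).toAffineMap +
    AffineMap.const ℝ _ (D (homog 0) / d.factorial), fun y => ?_⟩
  rw [signedVolume_eq, hD]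
  simp
  ring

theorem AffineIndependent.signedVolume_ne_zero {w : Fin (d + 1) → Pt d}
    (hw : AffineIndependent ℝ w) : signedVolume w ≠ 0 := by
  have h := (affineIndependent_iff_linearIndependent_vsub ℝ w 0).1 hw
  have h' : LinearIndependent ℝ fun i : Fin d => w i.succ - w 0 :=
    h.comp (fun i : Fin d => (⟨i.succ, Fin.succ_ne_zero i⟩ : {x // x ≠ (0 : Fin (d + 1))}))
      fun i j hij => by simpa using hij
  have h2 : LinearIndependent ℝ (Matrix.of fun i j : Fin d => w i.succ j - w 0 j).row :=
    h'.map' (WithLp.linearEquiv 2 ℝ (Fin d → ℝ)).toLinearMap (LinearEquiv.ker _)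
  rw [Matrix.linearIndependent_rows_iff_isUnit, Matrix.isUnit_iff_isUnit_det] at h2
  exact div_ne_zero h2.ne_zero (by positivity)

/-! ### Signs and induced orientations of faces. -/

/-- The sign of a real number, as an integer. -/
noncomputable def sgn (x : ℝ) : ℤ := (SignType.sign x : ℤ)

theorem sgn_mul (x y : ℝ) : sgn (x * y) = sgn x * sgn y := by simp [sgn, sign_mul]

theorem sgn_zero : sgn 0 = 0 := by simp [sgn]

theorem sgn_of_pos {x : ℝ} (h : 0 < x) : sgn x = 1 := by simp [sgn, sign_pos h]

theorem sgn_of_neg {x : ℝ} (h : x < 0) : sgn x = -1 := by simp [sgn, sign_neg h]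

theorem sgn_mul_self {x : ℝ} (h : x ≠ 0) : sgn x * sgn x = 1 := by
  rcases h.lt_or_gt with h | h
  · simp [sgn_of_neg h]
  · simp [sgn_of_pos h]

theorem sgn_mul_eq_abs (x : ℝ) : (sgn x : ℝ) * x = |x| := by
  rcases lt_trichotomy x 0 with h | rfl | h
  · simp [sgn_of_neg h, abs_of_neg h]
  · simp
  · simp [sgn_of_pos h, abs_of_pos h]

theorem sgn_neg_one_pow_mul (i : ℕ) (x : ℝ) : sgn ((-1) ^ i * x) = (-1) ^ i * sgn x := by
  rw [sgn_mul]
  rcases neg_one_pow_eq_or ℝ i with h | h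
  · rw [h, sgn_of_pos one_pos]
    rcases i.even_or_odd with h' | h'
    · simp [h'.neg_one_pow]
    · rw [h'.neg_one_pow] at h; norm_num at h
  · rw [h, sgn_of_neg (by norm_num)]
    rcases i.even_or_odd with h' | h'
    · rw [h'.neg_one_pow] at h; norm_num at h
    · simp [h'.neg_one_pow]

theorem sgn_sign_mul {n : ℕ} (σ : Equiv.Perm (Fin n)) (x : ℝ) :
    sgn (((Equiv.Perm.sign σ : ℤ) : ℝ) * x) = (Equiv.Perm.sign σ : ℤ) * sgn x := by
  rw [sgn_mul]
  congr 1
  rcases Int.units_eq_one_or (Equiv.Perm.sign σ) with h | h <;> rw [h]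
  · simpa using sgn_of_pos one_pos
  · simpa using sgn_of_neg (x := -1) (by norm_num)

theorem exists_perm_of_image_eq {α : Type*} [DecidableEq α] {u v : Fin d → α}
    (hu : Function.Injective u)
    (h : Finset.univ.image v = Finset.univ.image u) : ∃ σ : Equiv.Perm (Fin d), u ∘ σ = v := by
  have h1 : ∀ j, ∃ k, u k = v j := fun j => by
    have : v j ∈ Finset.univ.image u := h ▸ Finset.mem_image_of_mem _ (Finset.mem_univ j)
    simpa using this
  choose σ hσ using h1
  have hs : Function.Surjective σ := fun k => by
    have : u k ∈ Finset.univ.image v := h ▸ Finset.mem_image_of_mem _ (Finset.mem_univ k)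
    obtain ⟨j, -, hj⟩ := Finset.mem_image.1 this
    exact ⟨j, hu ((hσ j).trans hj)⟩
  exact ⟨Equiv.ofBijective σ ⟨Finite.injective_iff_surjective.2 hs, hs⟩, funext hσ⟩

open Classical in
/-- The coefficient of an oriented simplex in a face of a nondegenerate simplex `w`, in terms of
signs of volumes. -/
theorem faceCoeff_eq {w : Fin (d + 1) → Pt d} (hw : signedVolume w ≠ 0) (i : Fin (d + 1))
    (v : Fin d → Pt d) :
    (-1) ^ (i : ℕ) * (∑ σ : Equiv.Perm (Fin d),
      if (fun j => w (i.succAbove (σ j))) = v then (Equiv.Perm.sign σ : ℤ) else 0) =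
    if Finset.univ.image v = Finset.univ.image (fun j => w (i.succAbove j)) then
      sgn (signedVolume w) * sgn (signedVolume (Fin.cons (w i) v)) else 0 := by
  have hinj : Function.Injective w := fun a b hab => by
    by_contra hne
    exact hw (signedVolume_eq_zero_of_eq hab hne)
  have hinj' : Function.Injective fun j => w (i.succAbove j) :=
    hinj.comp Fin.succAbove_right_injective
  split_ifs with h
  · obtain ⟨σ, rfl⟩ := exists_perm_of_image_eq hinj' h
    -- The vertices are distinct, so exactly one permutation contributes.
    rw [Finset.sum_eq_single σ]
    · rw [if_pos (by rfl), signedVolume_cons_perm, signedVolume_cons_succAbove, sgn_sign_mul,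
        sgn_neg_one_pow_mul]
      have := sgn_mul_self hw
      linear_combination (-(-1) ^ (i : ℕ) * (Equiv.Perm.sign σ : ℤ)) * this
    · intro τ _ hτ
      rw [if_neg]
      intro hc
      apply hτ
      ext j
      have := congrFun hc j
      exact congrArg _ (hinj' this)
    · simp
  · rw [Finset.sum_eq_zero, mul_zero]
    intro σ _
    rw [if_neg]
    rintro rfl
    apply h
    ext x
    simp only [Finset.mem_image, Finset.mem_univ, true_and]
    exact ⟨fun ⟨j, hj⟩ => ⟨σ j, hj⟩, fun ⟨j, hj⟩ => ⟨σ.symm j, by simpa using hj⟩⟩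

/-! ### Discrete Stokes formula: pairing chains with coboundaries. -/

/-- The alternating sum of `q` over the faces of an ordered simplex. -/
noncomputable def faceSum (q : (Fin d → Pt d) → ℝ) (w : Fin (d + 1) → Pt d) : ℝ :=
  ∑ i : Fin (d + 1), (-1) ^ (i : ℕ) * q fun j => w (i.succAbove j)

namespace SimplicialChain

open Classical in
-- The factor `d!` appears because each face is met once in each of its orderings. All these terms
-- are equal, since `q` and the coefficient change by the same sign. The finite set `V` only makes
-- the sum over all orderings finite.
theorem sum_boundaryCoeff_mul (K : SimplicialChain d) {q : (Fin d → Pt d) → ℝ}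
    (hq : ∀ v (σ : Equiv.Perm (Fin d)), q (v ∘ σ) = (Equiv.Perm.sign σ : ℤ) * q v)
    {V : Finset (Fin d → Pt d)}
    (hV : ∀ s ∈ K.support, ∀ (i : Fin (d + 1)) (σ : Equiv.Perm (Fin d)),
      (fun j => s.points (i.succAbove (σ j))) ∈ V) :
    ∑ v ∈ V, (K.boundaryCoeff v : ℝ) * q v =
      d.factorial * K.sum fun s k => (k : ℝ) * faceSum q s.points := by
  simp only [boundaryCoeff, Finsupp.sum, Int.cast_sum, Finset.sum_mul]
  rw [Finset.sum_comm, Finset.mul_sum]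
  refine Finset.sum_congr rfl fun s hs => ?_
  push_cast
  simp only [Finset.mul_sum, Finset.sum_mul, faceSum]
  rw [Finset.sum_comm]
  refine Finset.sum_congr rfl fun i _ => ?_
  rw [Finset.sum_comm]
  have key : ∀ σ : Equiv.Perm (Fin d),
      ∑ v ∈ V, (K s : ℝ) * ((-1) ^ (i : ℕ) *
        (if (fun j => s.points (i.succAbove (σ j))) = v then ((Equiv.Perm.sign σ : ℤ) : ℝ)
          else 0)) * q v =
      (K s : ℝ) * ((-1) ^ (i : ℕ) * q fun j => s.points (i.succAbove j)) := by
    intro σ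
    rw [Finset.sum_eq_single (fun j => s.points (i.succAbove (σ j)))]
    · rw [if_pos rfl]
      have h := hq (fun j => s.points (i.succAbove j)) σ
      rw [Function.comp_def] at h
      rw [h]
      have h1 : ((Equiv.Perm.sign σ : ℤ) : ℝ) * ((Equiv.Perm.sign σ : ℤ) : ℝ) = 1 := by
        rw [← Int.cast_mul, ← Units.val_mul, Int.units_mul_self]; simp
      linear_combination
        (K s : ℝ) * (-1) ^ (i : ℕ) * (q fun j => s.points (i.succAbove j)) * h1
    · intro v _ hv
      rw [if_neg (Ne.symm hv)]; simp
    · intro h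
      exact absurd (hV s hs i σ) h
  rw [Finset.sum_congr rfl fun σ _ => key σ]
  simp [Fintype.card_perm]

/-- The pairing of a chain with a coboundary depends only on the boundary of the chain. -/
theorem sum_faceSum_eq {K K' : SimplicialChain d} {q q' : (Fin d → Pt d) → ℝ}
    (hq : ∀ v (σ : Equiv.Perm (Fin d)), q (v ∘ σ) = (Equiv.Perm.sign σ : ℤ) * q v)
    (hq' : ∀ v (σ : Equiv.Perm (Fin d)), q' (v ∘ σ) = (Equiv.Perm.sign σ : ℤ) * q' v)
    (h : ∀ v, (K.boundaryCoeff v : ℝ) * q v = (K'.boundaryCoeff v : ℝ) * q' v) :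
    (K.sum fun s k => (k : ℝ) * faceSum q s.points) =
      K'.sum fun s k => (k : ℝ) * faceSum q' s.points := by
  classical
  let V : Finset (Fin d → Pt d) := (K.support ∪ K'.support).biUnion fun s =>
    Finset.univ.biUnion fun i : Fin (d + 1) =>
      Finset.univ.image fun σ : Equiv.Perm (Fin d) => fun j => s.points (i.succAbove (σ j))
  have hV : ∀ s ∈ K.support ∪ K'.support, ∀ (i : Fin (d + 1)) (σ : Equiv.Perm (Fin d)),
      (fun j => s.points (i.succAbove (σ j))) ∈ V := fun s hs i σ =>
    Finset.mem_biUnion.2 ⟨s, hs, Finset.mem_biUnion.2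
      ⟨i, Finset.mem_univ _, Finset.mem_image_of_mem _ (Finset.mem_univ σ)⟩⟩
  have h1 := sum_boundaryCoeff_mul K hq (V := V) fun s hs => hV s (Finset.mem_union_left _ hs)
  have h2 := sum_boundaryCoeff_mul K' hq' (V := V) fun s hs => hV s (Finset.mem_union_right _ hs)
  rw [Finset.sum_congr rfl fun v _ => h v, h2] at h1
  exact (mul_left_cancel₀ (by positivity) h1).symm

end SimplicialChain

/-! ### Determinantal cochains and their coboundaries. -/

/-- The determinant of the coordinates of `d` points. -/
noncomputable def coordDet (v : Fin d → Pt d) : ℝ := Matrix.det (Matrix.of fun i j => v i j)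

/-- The `j`-th component of the normal vector of an ordered `(d - 1)`-simplex: the coordinate
determinant with `j`-th column replaced by ones. -/
noncomputable def normalDet (j : Fin d) (v : Fin d → Pt d) : ℝ :=
  Matrix.det (Matrix.of fun i k => if k = j then (1 : ℝ) else v i k)

theorem coordDet_perm (v : Fin d → Pt d) (σ : Equiv.Perm (Fin d)) :
    coordDet (v ∘ σ) = (Equiv.Perm.sign σ : ℤ) * coordDet v :=
  Matrix.det_permute σ (Matrix.of fun i j => v i j)

theorem normalDet_perm (j : Fin d) (v : Fin d → Pt d) (σ : Equiv.Perm (Fin d)) :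
    normalDet j (v ∘ σ) = (Equiv.Perm.sign σ : ℤ) * normalDet j v :=
  Matrix.det_permute σ (Matrix.of fun i k => if k = j then (1 : ℝ) else v i k)

theorem homogDet_eq_sum (w : Fin (d + 1) → Pt d) :
    homogDet w = ∑ i : Fin (d + 1), (-1) ^ (i : ℕ) * coordDet fun j => w (i.succAbove j) := by
  refine (Matrix.det_succ_column_zero (Matrix.of fun i => homog (w i))).trans ?_
  refine Finset.sum_congr rfl fun i _ => ?_
  simp [homog, coordDet, Matrix.submatrix]

theorem faceSum_coordDet (w : Fin (d + 1) → Pt d) : faceSum coordDet w = homogDet w :=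
  (homogDet_eq_sum w).symm

/-- Laplace expansion of the determinant with a column of values `f`. -/
theorem sum_mul_coordDet (f : Fin (d + 1) → ℝ) (w : Fin (d + 1) → Pt d) :
    ∑ i : Fin (d + 1), (-1) ^ (i : ℕ) * f i * (coordDet fun j => w (i.succAbove j)) =
      Matrix.det (Matrix.of fun i => (Fin.cons (f i) fun k => w i k : Fin (d + 1) → ℝ)) := by
  rw [Matrix.det_succ_column_zero]
  refine Finset.sum_congr rfl fun i _ => ?_
  simp [coordDet, Matrix.submatrix]

theorem sum_mul_normalDet (j : Fin d) (f : Fin (d + 1) → ℝ) (w : Fin (d + 1) → Pt d) :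
    ∑ i : Fin (d + 1), (-1) ^ (i : ℕ) * f i * (normalDet j fun k => w (i.succAbove k)) =
      Matrix.det (Matrix.of fun i =>
        (Fin.cons (f i) fun k => if k = j then 1 else w i k : Fin (d + 1) → ℝ)) := by
  rw [Matrix.det_succ_column_zero]
  refine Finset.sum_congr rfl fun i _ => ?_
  simp [normalDet, Matrix.submatrix]

theorem sum_apply_mul_coordDet (j : Fin d) (w : Fin (d + 1) → Pt d) :
    ∑ i : Fin (d + 1), (-1) ^ (i : ℕ) * w i j * (coordDet fun k => w (i.succAbove k)) = 0 := by
  rw [sum_mul_coordDet (fun i => w i j)]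
  exact Matrix.det_zero_of_column_eq (Fin.succ_ne_zero j).symm (by simp)

/-- The facet normals of a simplex add up to zero: the Laplace expansion is that of a matrix with
two columns of ones. -/
theorem sum_normalDet (j : Fin d) (w : Fin (d + 1) → Pt d) :
    ∑ i : Fin (d + 1), (-1) ^ (i : ℕ) * (normalDet j fun k => w (i.succAbove k)) = 0 := by
  have := sum_mul_normalDet j (fun _ => 1) w
  simp only [mul_one] at this
  rw [this]
  exact Matrix.det_zero_of_column_eq (Fin.succ_ne_zero j).symm (by simp)

theorem sum_apply_mul_normalDet (j k : Fin d) (w : Fin (d + 1) → Pt d) :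
    ∑ i : Fin (d + 1), (-1) ^ (i : ℕ) * w i k * (normalDet j fun k => w (i.succAbove k)) =
      if k = j then -homogDet w else 0 := by
  rw [sum_mul_normalDet j (fun i => w i k)]
  split_ifs with h
  · subst h
    -- The `k`-th coordinates stand in column `0` and the ones in column `k.succ`; exchanging them
    -- back gives the homogeneous matrix and the minus sign.
    have := Matrix.det_permute' (Equiv.swap 0 k.succ) (Matrix.of fun i => homog (w i))
    rw [Equiv.Perm.sign_swap (Fin.succ_ne_zero k).symm] at this
    simp only [Units.val_neg, Units.val_one, Int.cast_neg, Int.cast_one, neg_mul, one_mul] at this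
    rw [show homogDet w = (Matrix.of fun i => homog (w i)).det from rfl, ← this]
    congr 1
    ext i l
    refine Fin.cases ?_ (fun l => ?_) l
    · simp [homog]
    · by_cases hl : l = k
      · subst hl; simp [homog]
      · have : Equiv.swap 0 k.succ l.succ = l.succ :=
          Equiv.swap_apply_of_ne_of_ne (Fin.succ_ne_zero l) fun h => hl (Fin.succ_injective _ h)
        simp [homog, hl, this]
  · exact Matrix.det_zero_of_column_eq (Fin.succ_ne_zero k).symm (by simp [h])

/-- The vertex sum of a face is that of the simplex minus the opposite vertex, and the opposite
vertices contribute a determinant with a repeated column. Up to constants, this expresses the first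
moment of a simplex through its boundary. -/
theorem faceSum_coordDet_mul_sum (j : Fin d) (w : Fin (d + 1) → Pt d) :
    faceSum (fun v => coordDet v * ∑ a, v a j) w = homogDet w * ∑ a, w a j := by
  have h : ∀ i : Fin (d + 1), ∑ a, w (i.succAbove a) j = (∑ a, w a j) - w i j := fun i => by
    rw [Fin.sum_univ_succAbove (fun a => w a j) i]; ring
  simp only [faceSum, h, mul_sub, Finset.sum_sub_distrib]
  have := sum_apply_mul_coordDet j w
  rw [homogDet_eq_sum, Finset.sum_mul]
  rw [← sub_zero (∑ i : Fin (d + 1), _ * ∑ a, w a j), ← this]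
  congr 1 <;> exact Finset.sum_congr rfl fun i _ => by ring

/-! ### Squared edge sums and the displacement between circumcenter and centroid. -/

/-- The sum of the squared distances between the members of a family of points. -/
noncomputable def pairSqSum {n : ℕ} (v : Fin n → Pt d) : ℝ :=
  (∑ a, ∑ b, dist (v a) (v b) ^ 2) / 2

theorem edgeSqSum_image [DecidableEq (Pt d)] {v : Fin d → Pt d} (hv : Function.Injective v) :
    edgeSqSum (Finset.univ.image v) = pairSqSum v := by
  classical
  unfold edgeSqSum pairSqSum
  congr 1
  have h : ∑ p ∈ (Finset.univ.image v).offDiag, dist p.1 p.2 ^ 2 =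
      ∑ p ∈ Finset.univ.image v ×ˢ Finset.univ.image v, dist p.1 p.2 ^ 2 := by
    refine Finset.sum_subset (fun p hp => ?_) fun p hp hp' => ?_
    · rw [Finset.mem_offDiag] at hp
      exact Finset.mem_product.2 ⟨hp.1, hp.2.1⟩
    · rw [Finset.mem_product] at hp
      rw [Finset.mem_offDiag] at hp'
      have : p.1 = p.2 := by
        by_contra hne
        exact hp' ⟨hp.1, hp.2, hne⟩
      simp [this]
  rw [h, Finset.sum_product, Finset.sum_image fun a _ b _ hab => hv hab]
  exact Finset.sum_congr rfl fun a _ => Finset.sum_image fun a _ b _ hab => hv hab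

theorem pairSqSum_perm (v : Fin d → Pt d) (σ : Equiv.Perm (Fin d)) :
    pairSqSum (v ∘ σ) = pairSqSum v := by
  unfold pairSqSum
  rw [← Equiv.sum_comp σ fun a => ∑ b, dist (v a) (v b) ^ 2]
  congr 1
  exact Finset.sum_congr rfl fun a _ => Equiv.sum_comp σ fun b => dist (v (σ a)) (v b) ^ 2

theorem pairSqSum_succAbove (w : Fin (d + 1) → Pt d) (i : Fin (d + 1)) :
    pairSqSum (fun j => w (i.succAbove j)) = pairSqSum w - ∑ b, dist (w i) (w b) ^ 2 := by
  unfold pairSqSum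
  rw [Fin.sum_univ_succAbove (fun a => ∑ b, dist (w a) (w b) ^ 2) i]
  simp_rw [fun a => Fin.sum_univ_succAbove (fun b => dist (w (i.succAbove a)) (w b) ^ 2) i]
  rw [Finset.sum_add_distrib, Fin.sum_univ_succAbove (fun b => dist (w i) (w b) ^ 2) i]
  simp_rw [dist_comm _ (w i), dist_self]
  ring

theorem dist_sq_eq_sum (x y : Pt d) : dist x y ^ 2 = ∑ k, (x k - y k) ^ 2 := by
  rw [EuclideanSpace.dist_eq, Real.sq_sqrt (by positivity)]
  simp [Real.dist_eq, sq_abs]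

/-- The displacement between circumcenter and centroid of a simplex, expressed through its faces. -/
theorem faceSum_pairSqSum_mul_normalDet (j : Fin d) {w : Fin (d + 1) → Pt d} {o : Pt d} {r : ℝ}
    (ho : ∀ i, dist (w i) o = r) :
    faceSum (fun v => pairSqSum v * normalDet j v) w =
      2 * homogDet w * ((d + 1) * o j - ∑ a, w a j) := by
  -- Deleting `w i` removes the sum of `dist (w i) (w b) ^ 2`, whose only quadratic term in `w i` is
  -- `(d + 1) |w i|²`. On the circumsphere `|w i|² = r² - |o|² + 2 ⟨w i, o⟩`, so what remains is
  -- affine in `w i`.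
  obtain ⟨C, hC⟩ : ∃ C : ℝ, ∀ i, pairSqSum (fun j => w (i.succAbove j)) =
      C + ∑ k, w i k * (2 * (∑ a, w a k) - 2 * (d + 1) * o k) := by
    refine ⟨pairSqSum w - (d + 1) * (r ^ 2 - ∑ k, o k ^ 2) - ∑ b, ∑ k, w b k ^ 2, fun i => ?_⟩
    have h1 : ∑ k, w i k ^ 2 = r ^ 2 - ∑ k, o k ^ 2 + 2 * ∑ k, w i k * o k := by
      rw [← ho i, dist_sq_eq_sum, Finset.mul_sum, ← Finset.sum_sub_distrib,
        ← Finset.sum_add_distrib]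
      exact Finset.sum_congr rfl fun k _ => by ring
    have h2 : ∑ b, dist (w i) (w b) ^ 2 = (d + 1) * ∑ k, w i k ^ 2 -
        2 * (∑ k, w i k * ∑ a, w a k) + ∑ b, ∑ k, w b k ^ 2 := by
      simp only [dist_sq_eq_sum, sub_sq, Finset.sum_add_distrib, Finset.sum_sub_distrib]
      congr 2
      · simp
      · rw [Finset.sum_comm, Finset.mul_sum]
        refine Finset.sum_congr rfl fun k _ => ?_
        rw [Finset.mul_sum, Finset.mul_sum]
        exact Finset.sum_congr rfl fun k _ => by ring
    have h3 : ∑ k, w i k * (2 * (∑ a, w a k) - 2 * (d + 1) * o k) =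
        2 * (∑ k, w i k * ∑ a, w a k) - 2 * (d + 1) * ∑ k, w i k * o k := by
      rw [Finset.mul_sum, Finset.mul_sum, ← Finset.sum_sub_distrib]
      exact Finset.sum_congr rfl fun k _ => by ring
    rw [pairSqSum_succAbove, h2, h1, h3]
    ring
  have h4 : faceSum (fun v => pairSqSum v * normalDet j v) w =
      C * (∑ i : Fin (d + 1), (-1) ^ (i : ℕ) * (normalDet j fun k => w (i.succAbove k))) +
      ∑ k, (2 * (∑ a, w a k) - 2 * (d + 1) * o k) * ∑ i : Fin (d + 1),
        (-1) ^ (i : ℕ) * w i k * (normalDet j fun k => w (i.succAbove k)) := by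
    simp only [faceSum, hC, Finset.mul_sum]
    rw [Finset.sum_comm, ← Finset.sum_add_distrib]
    refine Finset.sum_congr rfl fun i _ => ?_
    rw [add_mul, mul_add, Finset.sum_mul, Finset.mul_sum]
    congr 1
    · ring
    · exact Finset.sum_congr rfl fun k _ => by ring
  -- The constant `C` is multiplied by the zero sum of normals; of the linear part only the `j`-th
  -- coefficient survives.
  rw [h4, sum_normalDet]
  simp_rw [sum_apply_mul_normalDet]
  simp
  ring

namespace SimplicialChain

/-- If the boundary of a chain is supported on simplices with the same sum of squared edge lengths,
then its circumcenter of mass agrees with its center of mass. -/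
theorem sum_circumcenter_eq {K : SimplicialChain d} {c : ℝ}
    (h : ∀ v, K.boundaryCoeff v ≠ 0 → pairSqSum v = c) (j : Fin d) :
    (K.sum fun s k => (k : ℝ) * homogDet s.points * ((d + 1) * s.circumcenter j)) =
      K.sum fun s k => (k : ℝ) * (homogDet s.points * ∑ a, s.points a j) := by
  have h1 := sum_faceSum_eq (K := K) (K' := K) (q := fun v => pairSqSum v * normalDet j v)
    (q' := fun v => c * normalDet j v)
    (fun v σ => by simp only [pairSqSum_perm, normalDet_perm]; ring)
    (fun v σ => by simp only [normalDet_perm]; ring)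
    -- The two cochains need to agree only where the boundary coefficient is nonzero; this is the
    -- only place where the constancy of the edge sums enters.
    (fun v => by
      by_cases hv : K.boundaryCoeff v = 0
      · simp [hv]
      · simp only [h v hv])
  have h2 : ∀ w : Fin (d + 1) → Pt d, faceSum (fun v => c * normalDet j v) w = 0 := fun w => by
    rw [← mul_zero c, ← sum_normalDet j w, Finset.mul_sum]
    exact Finset.sum_congr rfl fun i _ => by ring
  simp only [h2, mul_zero] at h1
  have h3 : ∀ s : Affine.Simplex ℝ (Pt d) d, faceSum (fun v => pairSqSum v * normalDet j v)
      s.points = 2 * homogDet s.points * ((d + 1) * s.circumcenter j - ∑ a, s.points a j) :=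
    fun s => faceSum_pairSqSum_mul_normalDet j s.dist_circumcenter_eq_circumradius
  simp only [h3] at h1
  simp only [Finsupp.sum, Finset.sum_const_zero] at h1 ⊢
  rw [← sub_eq_zero, ← Finset.sum_sub_distrib, ← mul_eq_zero_iff_left (two_ne_zero (α := ℝ)),
    ← h1, Finset.mul_sum]
  exact Finset.sum_congr rfl fun s _ => by ring

theorem sum_homogDet_eq {K K' : SimplicialChain d}
    (h : ∀ v, K.boundaryCoeff v = K'.boundaryCoeff v) :
    (K.sum fun s k => (k : ℝ) * homogDet s.points) =
      K'.sum fun s k => (k : ℝ) * homogDet s.points := by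
  simpa only [faceSum_coordDet] using
    sum_faceSum_eq (K := K) (K' := K') coordDet_perm coordDet_perm fun v => by rw [h]

theorem sum_homogDet_mul_sum_eq {K K' : SimplicialChain d}
    (h : ∀ v, K.boundaryCoeff v = K'.boundaryCoeff v) (j : Fin d) :
    (K.sum fun s k => (k : ℝ) * (homogDet s.points * ∑ a, s.points a j)) =
      K'.sum fun s k => (k : ℝ) * (homogDet s.points * ∑ a, s.points a j) := by
  have hq : ∀ (v : Fin d → Pt d) (σ : Equiv.Perm (Fin d)),
      (fun v : Fin d → Pt d => coordDet v * ∑ a, v a j) (v ∘ σ) =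
        (Equiv.Perm.sign σ : ℤ) * (fun v : Fin d → Pt d => coordDet v * ∑ a, v a j) v :=
    fun v σ => by
      simp only [coordDet_perm, Function.comp_apply, Equiv.sum_comp σ fun a => v a j]
      ring
  simpa only [faceSum_coordDet_mul_sum] using
    sum_faceSum_eq (K := K) (K' := K') (q := fun v => coordDet v * ∑ a, v a j)
      (q' := fun v => coordDet v * ∑ a, v a j) hq hq fun v => by rw [h]

end SimplicialChain

/-! ### Coordinates adapted to the cone over a facet. -/

section ConeBasis

/-- A linear relation between the vectors `f - p` either has nonzero coefficient sum, and then
normalizing it puts `p` in the affine span of `F`, or is an affine relation between the vertices,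
hence trivial. -/
theorem exists_coneBasis {F : Finset (Pt d)} {p : Pt d} (hcard : F.card = d)
    (hF : AffineIndependent ℝ ((↑) : F → Pt d)) (hp : p ∉ affineSpan ℝ (F : Set (Pt d))) :
    ∃ b : Module.Basis F ℝ (Pt d), ∀ f, b f = (f : Pt d) - p := by
  have h : LinearIndependent ℝ fun f : F => (f : Pt d) - p := by
    rw [Fintype.linearIndependent_iff]
    intro g hg
    have hs : ∑ f, g f = 0 := by
      by_contra hne
      apply hp
      have hw : ∑ f, (∑ f, g f)⁻¹ * g f = 1 := by
        rw [← Finset.mul_sum, inv_mul_cancel₀ hne]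
      have := affineCombination_mem_affineSpan hw ((↑) : F → Pt d)
      rw [Finset.affineCombination_eq_linear_combination _ _ _ hw] at this
      have h2 : ∑ f : F, ((∑ f, g f)⁻¹ * g f) • (f : Pt d) = p := by
        simp only [smul_sub, Finset.sum_sub_distrib, ← Finset.sum_smul] at hg
        rw [sub_eq_zero] at hg
        simp only [mul_smul, ← Finset.smul_sum]
        rw [hg, smul_smul, inv_mul_cancel₀ hne, one_smul]
      rw [h2] at this
      simpa using this
    refine fun i => affineIndependent_iff.1 hF Finset.univ g hs ?_ i (Finset.mem_univ _)
    simp only [smul_sub, Finset.sum_sub_distrib, ← Finset.sum_smul, hs, zero_smul, sub_zero] at hg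
    exact hg
  have hc : Fintype.card F = Module.finrank ℝ (Pt d) := by simp [hcard]
  refine ⟨Module.Basis.mk h (h.span_eq_top_of_card_eq_finrank' hc).ge, fun f => by simp⟩

variable {F : Finset (Pt d)} {p : Pt d} (b : Module.Basis F ℝ (Pt d))

/-- The sum of the coordinates of `y - p`, diminished by one: an affine function vanishing on the
hyperplane of `F` and negative at `p`. -/
noncomputable def height (p y : Pt d) : ℝ := ∑ f, b.repr (y - p) f - 1

theorem height_apex : height b p p = -1 := by simp [height]

theorem height_lineMap (x y : Pt d) (t : ℝ) :
    height b p (AffineMap.lineMap x y t) = (1 - t) * height b p x + t * height b p y := by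
  have : AffineMap.lineMap x y t - p = (1 - t) • (x - p) + t • (y - p) := by
    rw [AffineMap.lineMap_apply_module]; module
  simp only [height, this, map_add, map_smul, Finsupp.coe_add, Finsupp.coe_smul, Pi.add_apply,
    Pi.smul_apply, smul_eq_mul, Finset.sum_add_distrib, ← Finset.mul_sum]
  ring

theorem height_add_smul (u : Pt d) (t : ℝ) :
    height b p (p + t • u) = t * ∑ f, b.repr u f - 1 := by
  simp [height, Finset.mul_sum]

theorem continuous_repr_sub (f : F) : Continuous fun y => b.repr (y - p) f :=
  (LinearMap.continuous_of_finiteDimensional (b.coord f)).comp (continuous_id.sub continuous_const)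

variable {b} (hb : ∀ f, b f = (f : Pt d) - p)
include hb

theorem eq_add_sum_repr (y : Pt d) : y = p + ∑ f, b.repr (y - p) f • ((f : Pt d) - p) := by
  conv_lhs => rw [← add_sub_cancel p y, ← b.sum_repr (y - p)]
  simp only [hb]

theorem repr_sub_vertex [DecidableEq F] (f g : F) :
    b.repr ((f : Pt d) - p) g = if f = g then 1 else 0 := by
  rw [← hb, b.repr_self, Finsupp.single_apply]

theorem height_vertex (f : F) : height b p f = 0 := by
  classical
  simp only [height, repr_sub_vertex hb]
  simp

theorem height_eq_zero_of_mem_affineSpan {y : Pt d}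
    (hy : y ∈ affineSpan ℝ (F : Set (Pt d))) : height b p y = 0 := by
  refine affineSpan_induction hy (fun x hx => height_vertex hb ⟨x, hx⟩) ?_
  intro c u v w hu hv hw
  have : (c • (u -ᵥ v) +ᵥ w) - p = c • (u - p) - c • (v - p) + (w - p) := by
    simp only [vsub_eq_sub, vadd_eq_add]; module
  unfold height at hu hv hw ⊢
  rw [this]
  generalize u - p = u' at *
  generalize v - p = v' at *
  generalize w - p = w' at *
  simp only [map_add, map_sub, map_smul, Finsupp.coe_add, Finsupp.coe_sub, Finsupp.coe_smul,
    Pi.add_apply, Pi.sub_apply, Pi.smul_apply, smul_eq_mul, Finset.sum_add_distrib,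
    Finset.sum_sub_distrib, ← Finset.mul_sum]
  linear_combination c * hu - c * hv + hw

theorem repr_combination (w : F → ℝ) (hw : ∑ f, w f = 1) (g : F) :
    b.repr (∑ f, w f • (f : Pt d) - p) g = w g := by
  have : ∑ f, w f • (f : Pt d) - p = ∑ f, w f • b f := by
    simp only [hb, smul_sub, Finset.sum_sub_distrib, ← Finset.sum_smul, hw, one_smul]
  rw [this]
  simp [Finsupp.single_apply]

theorem eq_sum_of_height_eq_zero {y : Pt d} (h : height b p y = 0) :
    y = ∑ f, b.repr (y - p) f • (f : Pt d) := by
  conv_lhs => rw [eq_add_sum_repr hb y]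
  rw [height, sub_eq_zero] at h
  simp only [smul_sub, Finset.sum_sub_distrib, ← Finset.sum_smul, h, one_smul,
    add_sub_cancel]

theorem mem_convexHull_of_subset_iff {G : Finset (Pt d)} (hG : G ⊆ F) {y : Pt d} :
    y ∈ convexHull ℝ (G : Set (Pt d)) ↔ (∀ f, 0 ≤ b.repr (y - p) f) ∧ height b p y = 0 ∧
      ∀ f : F, (f : Pt d) ∉ G → b.repr (y - p) f = 0 := by
  classical
  rw [Finset.mem_convexHull']
  constructor
  · rintro ⟨w, hw, hw1, rfl⟩
    let w' : F → ℝ := fun f => if (f : Pt d) ∈ G then w f else 0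
    have e1 : ∑ f, w' f = 1 := by
      rw [← hw1, Finset.sum_coe_sort F fun f => if f ∈ G then w f else 0, Finset.sum_ite_mem,
        Finset.inter_eq_right.2 hG]
    have e2 : ∑ y ∈ G, w y • y = ∑ f, w' f • (f : Pt d) := by
      rw [Finset.sum_coe_sort F fun f => (if f ∈ G then w f else 0) • f]
      simp only [ite_smul, zero_smul]
      rw [Finset.sum_ite_mem, Finset.inter_eq_right.2 hG]
    rw [e2]
    refine ⟨fun f => ?_, ?_, fun f hf => ?_⟩
    · rw [repr_combination hb w' e1]
      simp only [w']
      split_ifs with h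
      exacts [hw _ h, le_rfl]
    · simp only [height, repr_combination hb w' e1, e1, sub_self]
    · rw [repr_combination hb w' e1]
      simp [w', hf]
  · rintro ⟨h1, h2, h3⟩
    have h4 := eq_sum_of_height_eq_zero hb h2
    let w : Pt d → ℝ := fun x => if hx : x ∈ F then b.repr (y - p) ⟨x, hx⟩ else 0
    have hw : ∀ f : F, w f = b.repr (y - p) f := fun f => by simp [w]
    refine ⟨w, fun x hx => (h1 ⟨x, hG hx⟩).trans_eq (hw ⟨x, hG hx⟩).symm, ?_, ?_⟩
    · rw [Finset.sum_subset hG fun x hx hx' => (hw ⟨x, hx⟩).trans (h3 ⟨x, hx⟩ hx'),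
        ← Finset.sum_coe_sort F]
      rw [height, sub_eq_zero] at h2
      rw [← h2]
      exact Finset.sum_congr rfl fun f _ => hw f
    · rw [Finset.sum_subset hG fun x hx hx' => by
          rw [(hw ⟨x, hx⟩).trans (h3 ⟨x, hx⟩ hx'), zero_smul], ← Finset.sum_coe_sort F]
      conv_rhs => rw [h4]
      exact Finset.sum_congr rfl fun f _ => by rw [hw f]

theorem mem_convexHull_iff_repr {y : Pt d} :
    y ∈ convexHull ℝ (F : Set (Pt d)) ↔ (∀ f, 0 ≤ b.repr (y - p) f) ∧ height b p y = 0 := by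
  rw [mem_convexHull_of_subset_iff hb subset_rfl]
  exact ⟨fun h => ⟨h.1, h.2.1⟩, fun h => ⟨h.1, h.2, fun f hf => absurd f.2 hf⟩⟩

theorem mem_intrinsicInterior_iff_repr {y : Pt d} :
    y ∈ intrinsicInterior ℝ (convexHull ℝ (F : Set (Pt d))) ↔
      (∀ f, 0 < b.repr (y - p) f) ∧ height b p y = 0 := by
  have hspan : affineSpan ℝ (convexHull ℝ (F : Set (Pt d))) = affineSpan ℝ (F : Set (Pt d)) :=
    affineSpan_convexHull _
  constructor
  · intro hy
    have hyF := (mem_convexHull_iff_repr hb).1 (intrinsicInterior_subset hy)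
    refine ⟨fun f => (hyF.1 f).lt_of_ne fun h0 => ?_, hyF.2⟩
    obtain ⟨z, hz, rfl⟩ := mem_intrinsicInterior.1 hy
    have hfspan : (f : Pt d) ∈ affineSpan ℝ (convexHull ℝ (F : Set (Pt d))) :=
      subset_affineSpan _ _ (subset_convexHull _ _ f.2)
    -- If the coordinate at `f` vanishes, moving slightly away from `f`, at negative `t`, stays in
    -- the hull by interiority but makes that coordinate equal to `t < 0`.
    let γ : ℝ → affineSpan ℝ (convexHull ℝ (F : Set (Pt d))) := fun t =>
      ⟨AffineMap.lineMap (z : Pt d) (f : Pt d) t, AffineMap.lineMap_mem t z.2 hfspan⟩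
    have hγ : Continuous γ := (AffineMap.lineMap_continuous).subtype_mk _
    have hγ0 : γ 0 = z := by ext1; simp [γ]
    have hev : ∀ᶠ t in 𝓝 (0 : ℝ), γ t ∈ ((↑) ⁻¹' convexHull ℝ (F : Set (Pt d)) :
        Set (affineSpan ℝ (convexHull ℝ (F : Set (Pt d))))) :=
      hγ.continuousAt.eventually (by rw [hγ0]; exact mem_interior_iff_mem_nhds.1 hz)
    obtain ⟨t, ht, htneg⟩ := (hev.filter_mono nhdsWithin_le_nhds
      |>.and (self_mem_nhdsWithin (s := Iio (0 : ℝ)))).exists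
    have h1 := ((mem_convexHull_iff_repr hb).1 ht).1 f
    classical
    have h2 : (γ t : Pt d) - p = (1 - t) • ((z : Pt d) - p) + t • ((f : Pt d) - p) := by
      simp only [γ]; rw [AffineMap.lineMap_apply_module]; module
    rw [h2] at h1
    simp only [map_add, map_smul, Finsupp.coe_add, Finsupp.coe_smul, Pi.add_apply, Pi.smul_apply,
      smul_eq_mul, ← h0, repr_sub_vertex hb, if_true] at h1
    simp only [mul_zero, mul_one, zero_add] at h1
    exact absurd h1 (not_le.2 htneg)
  · rintro ⟨h1, h2⟩
    have hyF : y ∈ convexHull ℝ (F : Set (Pt d)) :=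
      (mem_convexHull_iff_repr hb).2 ⟨fun f => (h1 f).le, h2⟩
    refine mem_intrinsicInterior.2 ⟨⟨y, subset_affineSpan _ _ hyF⟩, ?_, rfl⟩
    rw [mem_interior_iff_mem_nhds]
    have h3 : ∀ᶠ x in 𝓝 y, ∀ f, 0 < b.repr (x - p) f :=
      eventually_all.2 fun f => (continuous_repr_sub b f).continuousAt.eventually_const_lt (h1 f)
    filter_upwards [continuous_subtype_val.continuousAt.eventually h3] with x hx
    refine (mem_convexHull_iff_repr hb).2 ⟨fun f => (hx f).le, ?_⟩
    exact height_eq_zero_of_mem_affineSpan hb (hspan ▸ x.2)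

/-- Both sides are affine in `y`, vanish at the vertices in `F` and agree at `p`, where the height
is `-1`. Thus the side of the facet hyperplane determines the orientation of the cone. -/
theorem height_mul_signedVolume {v : Fin d → Pt d} (hv : ∀ f ∈ F, f ∈ Set.range v)
    (y : Pt d) : signedVolume (Fin.cons y v) = -height b p y * signedVolume (Fin.cons p v) := by
  obtain ⟨L, hL⟩ := exists_affineMap_signedVolume v
  have h0 : ∀ f : F, L.linear ((f : Pt d) - p) = - L p := fun f => by
    obtain ⟨j, hj⟩ := hv f f.2
    have h1 : L f = 0 := by
      rw [hL]
      exact signedVolume_eq_zero_of_eq (i := 0) (j := j.succ) (by simp [hj])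
        (Fin.succ_ne_zero j).symm
    rw [← vsub_eq_sub, L.linearMap_vsub, h1]
    simp
  have h1 : L y = L p + L.linear (y - p) := by
    rw [← vsub_eq_sub, L.linearMap_vsub]; simp
  rw [← hL, ← hL, h1]
  conv_lhs => rw [← b.sum_repr (y - p)]
  simp only [map_sum, map_smul, hb, h0, height, smul_eq_mul, ← Finset.sum_mul]
  ring

end ConeBasis

/-! ### Local structure of the polytope along a facet, and facet signs. -/

theorem IsPreconnected.subset_interior_or_subset_compl {X : Type*} [TopologicalSpace X]
    {s A : Set X} (hs : IsClosed s) (hA : IsPreconnected A) (h : Disjoint A (frontier s)) :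
    A ⊆ interior s ∨ A ⊆ sᶜ := by
  refine hA.subset_or_subset isOpen_interior hs.isOpen_compl
    (disjoint_compl_right.mono_left interior_subset) fun x hx => ?_
  by_cases hxs : x ∈ s
  · left
    by_contra hi
    exact h.le_bot ⟨hx, hs.frontier_eq ▸ ⟨hxs, hi⟩⟩
  · exact Or.inr hxs

namespace SimplicialPolytope

variable {P : SimplicialPolytope d}

theorem finite_facets (P : SimplicialPolytope d) : P.boundary.facets.Finite :=
  P.finite_faces.subset fun _ h => h.1

theorem frontier_eq (P : SimplicialPolytope d) :
    frontier P.carrier = ⋃ F ∈ P.boundary.facets, convexHull ℝ (F : Set (Pt d)) := by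
  rw [← P.space_boundary]
  apply subset_antisymm
  · refine iUnion₂_subset fun s hs => ?_
    obtain ⟨F, hsF, hF⟩ := P.finite_faces.exists_le_maximal hs
    exact (convexHull_mono (Finset.coe_subset.2 hsF)).trans (subset_biUnion_of_mem
      (u := fun F : Finset (Pt d) => convexHull ℝ (F : Set (Pt d)))
      (show F ∈ P.boundary.facets from ⟨hF.1, fun t ht hFt => hF.eq_of_le ht hFt⟩))
  · exact iUnion₂_subset fun F hF => P.boundary.convexHull_subset_space hF.1

theorem isClosed_carrier (P : SimplicialPolytope d) : IsClosed P.carrier := P.isCompact.isClosed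

theorem convexHull_subset_frontier {F : Finset (Pt d)} (hF : F ∈ P.boundary.facets) :
    convexHull ℝ (F : Set (Pt d)) ⊆ frontier P.carrier := by
  rw [frontier_eq]
  exact subset_biUnion_of_mem (u := fun F : Finset (Pt d) => convexHull ℝ (F : Set (Pt d))) hF

section Facet

variable {F : Finset (Pt d)} {p : Pt d} {b : Module.Basis F ℝ (Pt d)}

/-- In a simplicial complex the two hulls meet in the hull of the common vertices. All coordinates
of `x` are positive, so every vertex of `F` is common, and maximality of facets gives equality. -/
theorem eq_of_mem_convexHull_facet (hF : F ∈ P.boundary.facets)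
    (hb : ∀ f, b f = (f : Pt d) - p) {x : Pt d} (hx : ∀ f, 0 < b.repr (x - p) f)
    (hx0 : height b p x = 0) {G : Finset (Pt d)}
    (hG : G ∈ P.boundary.facets) (hxG : x ∈ convexHull ℝ (G : Set (Pt d))) : G = F := by
  classical
  have h := P.boundary.inter_subset_convexHull hF.1 hG.1
    ⟨(mem_convexHull_iff_repr hb).2 ⟨fun f => (hx f).le, hx0⟩, hxG⟩
  rw [← Finset.coe_inter, mem_convexHull_of_subset_iff hb Finset.inter_subset_left] at h
  refine ((P.boundary.mem_facets.1 hF).2 G hG.1 fun f hf => ?_).symm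
  by_contra hfG
  exact (hx ⟨f, hf⟩).ne' (h.2.2 ⟨f, hf⟩ fun hc => hfG (Finset.mem_inter.1 hc).2)

variable (P b p) in
/-- Near `x`, the polytope lies on the side of the apex `p` of the facet hyperplane. -/
def InnerAt (x : Pt d) : Prop :=
  ∀ᶠ y in 𝓝 x, (height b p y < 0 → y ∈ interior P.carrier) ∧
    (0 < height b p y → y ∉ P.carrier)

variable (P b p) in
/-- Near `x`, the polytope lies on the side of the facet hyperplane opposite to the apex `p`. -/
def OuterAt (x : Pt d) : Prop :=
  ∀ᶠ y in 𝓝 x, (height b p y < 0 → y ∉ P.carrier) ∧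
    (0 < height b p y → y ∈ interior P.carrier)

/-- A small ball around `x` avoids the other facets, so its part of the frontier is its part of the
hyperplane. Each open half ball is convex, hence entirely in the interior or in the complement. Both
in the interior would make `x` an interior point; both in the complement would contradict that the
polytope is the closure of its interior. -/
theorem innerAt_or_outerAt (hF : F ∈ P.boundary.facets)
    (hb : ∀ f, b f = (f : Pt d) - p) {x : Pt d} (hx : ∀ f, 0 < b.repr (x - p) f)
    (hx0 : height b p x = 0) : P.InnerAt p b x ∨ P.OuterAt p b x := by
  have hxF : x ∈ convexHull ℝ (F : Set (Pt d)) :=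
    (mem_convexHull_iff_repr hb).2 ⟨fun f => (hx f).le, hx0⟩
  have hxfr := convexHull_subset_frontier hF hxF
  have hcl : IsClosed (⋃ G ∈ P.boundary.facets \ {F}, convexHull ℝ (G : Set (Pt d))) :=
    (P.finite_facets.subset sdiff_subset).isClosed_biUnion
      fun G _ => (G.finite_toSet.isCompact_convexHull ℝ).isClosed
  have hxn : x ∉ ⋃ G ∈ P.boundary.facets \ {F}, convexHull ℝ (G : Set (Pt d)) := by
    simp only [mem_iUnion, not_exists]
    exact fun G hG hxG => hG.2 (eq_of_mem_convexHull_facet hF hb hx hx0 hG.1 hxG)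
  have hev : ∀ᶠ y in 𝓝 x, (∀ f, 0 < b.repr (y - p) f) ∧
      y ∉ ⋃ G ∈ P.boundary.facets \ {F}, convexHull ℝ (G : Set (Pt d)) :=
    (eventually_all.2 fun f => (continuous_repr_sub b f).continuousAt.eventually_const_lt
      (hx f)).and (hcl.isOpen_compl.mem_nhds hxn)
  obtain ⟨r, hr, hball⟩ := Metric.eventually_nhds_iff_ball.1 hev
  have hfr : ∀ y ∈ Metric.ball x r, y ∈ frontier P.carrier ↔ height b p y = 0 := by
    intro y hy
    constructor
    · intro h
      rw [frontier_eq] at h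
      simp only [mem_iUnion] at h
      obtain ⟨G, hG, hyG⟩ := h
      by_cases hGF : G = F
      · subst hGF
        exact ((mem_convexHull_iff_repr hb).1 hyG).2
      · exact absurd (mem_biUnion (show G ∈ P.boundary.facets \ {F} from ⟨hG, hGF⟩) hyG)
          (hball y hy).2
    · intro h
      exact convexHull_subset_frontier hF
        ((mem_convexHull_iff_repr hb).2 ⟨fun f => ((hball y hy).1 f).le, h⟩)
  have hlin : ∀ (u v : Pt d) (s t : ℝ), s + t = 1 →
      height b p (s • u + t • v) = s * height b p u + t * height b p v := by
    intro u v s t hst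
    have := height_lineMap b (p := p) u v t
    rw [AffineMap.lineMap_apply_module, show 1 - t = s by linarith] at this
    exact this
  have hneg : IsPreconnected (Metric.ball x r ∩ {y | height b p y < 0}) := by
    refine ((convex_ball x r).inter fun u hu v hv s t hs ht hst => ?_).isPreconnected
    simp only [mem_ofPred_eq] at hu hv ⊢
    rw [hlin u v s t hst]
    rcases hs.eq_or_lt with rfl | hs
    · rw [zero_add] at hst; subst hst; simpa using hv
    · nlinarith [mul_neg_of_pos_of_neg hs hu, mul_nonpos_of_nonneg_of_nonpos ht hv.le]
  have hpos : IsPreconnected (Metric.ball x r ∩ {y | 0 < height b p y}) := by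
    refine ((convex_ball x r).inter fun u hu v hv s t hs ht hst => ?_).isPreconnected
    simp only [mem_ofPred_eq] at hu hv ⊢
    rw [hlin u v s t hst]
    rcases hs.eq_or_lt with rfl | hs
    · rw [zero_add] at hst; subst hst; simpa using hv
    · nlinarith [mul_pos hs hu, mul_nonneg ht hv.le]
  have h1 := hneg.subset_interior_or_subset_compl P.isClosed_carrier
    (disjoint_left.2 fun y hy hyf => hy.2.ne ((hfr y hy.1).1 hyf))
  have h2 := hpos.subset_interior_or_subset_compl P.isClosed_carrier
    (disjoint_left.2 fun y hy hyf => hy.2.ne' ((hfr y hy.1).1 hyf))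
  have hb' : ∀ᶠ y in 𝓝 x, y ∈ Metric.ball x r := Metric.ball_mem_nhds x hr
  rcases h1 with h1 | h1 <;> rcases h2 with h2 | h2
  · exfalso
    rw [P.isClosed_carrier.frontier_eq] at hxfr
    apply hxfr.2
    rw [mem_interior_iff_mem_nhds]
    filter_upwards [hb'] with y hy
    rcases lt_trichotomy (height b p y) 0 with h | h | h
    · exact interior_subset (h1 ⟨hy, h⟩)
    · exact P.isClosed_carrier.frontier_subset ((hfr y hy).2 h)
    · exact interior_subset (h2 ⟨hy, h⟩)
  · left
    filter_upwards [hb'] with y hy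
    exact ⟨fun h => h1 ⟨hy, h⟩, fun h => h2 ⟨hy, h⟩⟩
  · right
    filter_upwards [hb'] with y hy
    exact ⟨fun h => h1 ⟨hy, h⟩, fun h => h2 ⟨hy, h⟩⟩
  · exfalso
    have hx' : x ∈ closure (interior P.carrier) := by
      rw [P.closure_interior]
      exact P.isClosed_carrier.frontier_subset hxfr
    obtain ⟨y, hy, hyi⟩ := mem_closure_iff_nhds.1 hx' _ hb'
    rcases lt_trichotomy (height b p y) 0 with h | h | h
    · exact h1 ⟨hy, h⟩ (interior_subset hyi)
    · exact ((hfr y hy).2 h).2 hyi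
    · exact h2 ⟨hy, h⟩ (interior_subset hyi)

theorem height_lineMap_of_eq_zero {x : Pt d} (hx0 : height b p x = 0) (q : Pt d) (ε : ℝ) :
    height b p (AffineMap.lineMap x q ε) = ε * height b p q := by
  rw [height_lineMap, hx0, mul_zero, zero_add]

theorem tendsto_lineMap (x q : Pt d) :
    Tendsto (fun ε : ℝ => AffineMap.lineMap x q ε) (𝓝[>] (0 : ℝ)) (𝓝 x) := by
  have h : Continuous fun ε : ℝ => (AffineMap.lineMap x q ε : Pt d) := AffineMap.lineMap_continuous
  have := h.tendsto 0
  rw [AffineMap.lineMap_apply_zero] at this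
  exact this.mono_left nhdsWithin_le_nhds

theorem InnerAt.eventually_mem {x : Pt d} (h : P.InnerAt p b x) (hx0 : height b p x = 0) {q : Pt d}
    (hq : height b p q < 0) :
    ∀ᶠ ε in 𝓝[>] (0 : ℝ), AffineMap.lineMap x q ε ∈ interior P.carrier := by
  filter_upwards [(tendsto_lineMap x q).eventually h, self_mem_nhdsWithin] with ε h1 h2
  apply h1.1
  rw [height_lineMap_of_eq_zero hx0]
  exact mul_neg_of_pos_of_neg h2 hq

theorem InnerAt.eventually_notMem {x : Pt d} (h : P.InnerAt p b x) (hx0 : height b p x = 0)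
    {q : Pt d} (hq : 0 < height b p q) :
    ∀ᶠ ε in 𝓝[>] (0 : ℝ), AffineMap.lineMap x q ε ∉ P.carrier := by
  filter_upwards [(tendsto_lineMap x q).eventually h, self_mem_nhdsWithin] with ε h1 h2
  apply h1.2
  rw [height_lineMap_of_eq_zero hx0]
  exact mul_pos h2 hq

theorem OuterAt.eventually_mem {x : Pt d} (h : P.OuterAt p b x) (hx0 : height b p x = 0) {q : Pt d}
    (hq : 0 < height b p q) :
    ∀ᶠ ε in 𝓝[>] (0 : ℝ), AffineMap.lineMap x q ε ∈ interior P.carrier := by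
  filter_upwards [(tendsto_lineMap x q).eventually h, self_mem_nhdsWithin] with ε h1 h2
  apply h1.2
  rw [height_lineMap_of_eq_zero hx0]
  exact mul_pos h2 hq

theorem OuterAt.eventually_notMem {x : Pt d} (h : P.OuterAt p b x) (hx0 : height b p x = 0)
    {q : Pt d} (hq : height b p q < 0) :
    ∀ᶠ ε in 𝓝[>] (0 : ℝ), AffineMap.lineMap x q ε ∉ P.carrier := by
  filter_upwards [(tendsto_lineMap x q).eventually h, self_mem_nhdsWithin] with ε h1 h2
  apply h1.1
  rw [height_lineMap_of_eq_zero hx0]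
  exact mul_neg_of_pos_of_neg h2 hq

theorem InnerAt.not_outerAt {x : Pt d} (h : P.InnerAt p b x) (hx0 : height b p x = 0) :
    ¬ P.OuterAt p b x := fun h' => by
  have hp : height b p p < 0 := by rw [height_apex]; norm_num
  obtain ⟨ε, h1, h2⟩ := ((h.eventually_mem hx0 hp).and (h'.eventually_notMem hx0 hp)).exists
  exact h2 (interior_subset h1)

/-- The relative interior of the facet is convex, hence connected, and the two local alternatives
are open and mutually exclusive on it. -/
theorem forall_innerAt_or_forall_outerAt (hF : F ∈ P.boundary.facets)
    (hb : ∀ f, b f = (f : Pt d) - p) :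
    (∀ x, (∀ f, 0 < b.repr (x - p) f) → height b p x = 0 → P.InnerAt p b x) ∨
      ∀ x, (∀ f, 0 < b.repr (x - p) f) → height b p x = 0 → P.OuterAt p b x := by
  have hc : Convex ℝ {x | (∀ f, 0 < b.repr (x - p) f) ∧ height b p x = 0} := by
    intro u hu v hv s t hs ht hst
    have hline : s • u + t • v = AffineMap.lineMap u v t := by
      rw [AffineMap.lineMap_apply_module, show 1 - t = s by linarith]
    refine ⟨fun f => ?_, ?_⟩
    · have : s • u + t • v - p = s • (u - p) + t • (v - p) := by
        rw [show s = 1 - t by linarith]; module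
      rw [this]
      simp only [map_add, map_smul, Finsupp.coe_add, Finsupp.coe_smul, Pi.add_apply,
        Pi.smul_apply, smul_eq_mul]
      rcases hs.eq_or_lt with rfl | hs
      · rw [zero_add] at hst; subst hst; simpa using hv.1 f
      · exact add_pos_of_pos_of_nonneg (mul_pos hs (hu.1 f)) (mul_nonneg ht (hv.1 f).le)
    · rw [hline, height_lineMap, hu.2, hv.2]; simp
  have := isPreconnected_iff_subset_of_disjoint.1 hc.isPreconnected {x | P.InnerAt p b x}
    {x | P.OuterAt p b x}
    (isOpen_iff_mem_nhds.2 fun x hx => eventually_eventually_nhds.2 hx)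
    (isOpen_iff_mem_nhds.2 fun x hx => eventually_eventually_nhds.2 hx)
    (fun x hx => innerAt_or_outerAt hF hb hx.1 hx.2)
    (eq_empty_of_forall_notMem fun x hx => hx.2.1.not_outerAt hx.1.2 hx.2.2)
  exact this.imp (fun h x h1 h2 => h ⟨h1, h2⟩) fun h x h1 h2 => h ⟨h1, h2⟩

theorem exists_relInterior (hF : F ∈ P.boundary.facets) (hb : ∀ f, b f = (f : Pt d) - p) :
    ∃ x, (∀ f, 0 < b.repr (x - p) f) ∧ height b p x = 0 := by
  have hne : (0 : ℝ) < F.card :=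
    Nat.cast_pos.2 (Finset.card_pos.2 (P.boundary.nonempty_of_mem_faces hF.1))
  have h1 : ∑ _f : F, (F.card : ℝ)⁻¹ = 1 := by
    simp [hne.ne']
  refine ⟨∑ f : F, (F.card : ℝ)⁻¹ • (f : Pt d), fun f => ?_, ?_⟩
  · rw [repr_combination hb (fun _ => (F.card : ℝ)⁻¹) h1]
    positivity
  · simp only [height, repr_combination hb (fun _ => (F.card : ℝ)⁻¹) h1, h1, sub_self]

open Classical in
variable (P p F) in
/-- `1` or `-1`, according to whether the apex `p` is on the inner side of the facet. -/
noncomputable def faceSign : ℤ := if p ∈ P.innerSide F then 1 else -1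

theorem faceSign_cases (hF : F ∈ P.boundary.facets) (hb : ∀ f, b f = (f : Pt d) - p) :
    (P.faceSign F p = 1 ∧ (∀ q ∈ P.innerSide F, height b p q ≤ 0) ∧ p ∈ P.innerSide F ∧
      ∀ x, (∀ f, 0 < b.repr (x - p) f) → height b p x = 0 → P.InnerAt p b x) ∨
    (P.faceSign F p = -1 ∧ (∀ q ∈ P.innerSide F, 0 ≤ height b p q) ∧
      (∃ q ∈ P.innerSide F, height b p q = 1) ∧
      ∀ x, (∀ f, 0 < b.repr (x - p) f) → height b p x = 0 → P.OuterAt p b x) := by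
  obtain ⟨x₀, hx₀, hx₀'⟩ := exists_relInterior hF hb
  rcases forall_innerAt_or_forall_outerAt hF hb with h | h
  · left
    have hp : p ∈ P.innerSide F := fun x hx => by
      rw [mem_intrinsicInterior_iff_repr hb] at hx
      exact (h x hx.1 hx.2).eventually_mem hx.2 (by rw [height_apex]; norm_num)
    refine ⟨if_pos hp, fun q hq => ?_, hp, h⟩
    by_contra hlt
    obtain ⟨ε, h1, h2⟩ := ((hq x₀ ((mem_intrinsicInterior_iff_repr hb).2 ⟨hx₀, hx₀'⟩)).and
      ((h x₀ hx₀ hx₀').eventually_notMem hx₀' (not_le.1 hlt))).exists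
    exact h2 (interior_subset h1)
  · right
    have hq : ∀ q ∈ P.innerSide F, 0 ≤ height b p q := fun q hq => by
      by_contra hlt
      obtain ⟨ε, h1, h2⟩ := ((hq x₀ ((mem_intrinsicInterior_iff_repr hb).2 ⟨hx₀, hx₀'⟩)).and
        ((h x₀ hx₀ hx₀').eventually_notMem hx₀' (not_le.1 hlt))).exists
      exact h2 (interior_subset h1)
    -- The reflection of `p` in `x₀` lies across the facet hyperplane, at the opposite height.
    have hq1 : height b p (AffineMap.lineMap p x₀ (2 : ℝ)) = 1 := by
      rw [height_lineMap, hx₀', height_apex]; norm_num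
    refine ⟨if_neg fun hp => ?_, hq, ⟨AffineMap.lineMap p x₀ (2 : ℝ), fun x hx => ?_, hq1⟩, h⟩
    · have := hq p hp
      rw [height_apex] at this
      norm_num at this
    · rw [mem_intrinsicInterior_iff_repr hb] at hx
      exact (h x hx.1 hx.2).eventually_mem hx.2 (by rw [hq1]; norm_num)

open Classical in
theorem cycleCoeff_def [DecidableEq (Pt d)] (v : Fin d → Pt d) :
    P.cycleCoeff v = if Finset.univ.image v ∈ P.boundary.facets then
      if ∃ p ∈ P.innerSide (Finset.univ.image v), 0 < signedVolume (Fin.cons p v) then 1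
      else if ∃ p ∈ P.innerSide (Finset.univ.image v), signedVolume (Fin.cons p v) < 0 then -1
      else 0
    else 0 := by
  unfold cycleCoeff
  congr!

/-- Points on the inner side all give orientations compatible with `p` when `p` is on that side, and
with its opposite otherwise. Replacing them by the fixed apex therefore costs exactly the facet
sign. -/
theorem cycleCoeff_eq [DecidableEq (Pt d)] (hF : F ∈ P.boundary.facets) (hb : ∀ f, b f = (f : Pt d) - p)
    {v : Fin d → Pt d} (hv : Finset.univ.image v = F) :
    P.cycleCoeff v = P.faceSign F p * sgn (signedVolume (Fin.cons p v)) := by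
  have hvol := height_mul_signedVolume hb (v := v) fun f hf => by
    rw [← hv] at hf
    simpa using hf
  rw [cycleCoeff_def, hv, if_pos hF]
  rcases faceSign_cases hF hb with ⟨hs, hle, hp, -⟩ | ⟨hs, hle, ⟨q, hq, hq1⟩, -⟩
  · rw [hs, one_mul]
    rcases lt_trichotomy (signedVolume (Fin.cons p v)) 0 with h | h | h
    · rw [sgn_of_neg h, if_neg, if_pos ⟨p, hp, h⟩]
      rintro ⟨q, hq, hpos⟩
      rw [hvol] at hpos
      nlinarith [mul_nonneg (neg_nonneg.2 (hle q hq)) (neg_nonneg.2 h.le)]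
    · rw [h, sgn_zero, if_neg, if_neg] <;>
      · rintro ⟨q, hq, hpos⟩
        rw [hvol, h] at hpos
        simp at hpos
    · rw [sgn_of_pos h, if_pos ⟨p, hp, h⟩]
  · rw [hs]
    have hvq : signedVolume (Fin.cons q v) = -signedVolume (Fin.cons p v) := by
      rw [hvol, hq1, neg_mul, one_mul]
    rcases lt_trichotomy (signedVolume (Fin.cons p v)) 0 with h | h | h
    · rw [sgn_of_neg h, if_pos ⟨q, hq, by rw [hvq]; linarith⟩]
      norm_num
    · rw [h, sgn_zero, if_neg, if_neg]
      · simp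
      all_goals
        rintro ⟨q, hq, hpos⟩
        rw [hvol, h] at hpos
        simp at hpos
    · rw [sgn_of_pos h, if_neg, if_pos ⟨q, hq, by rw [hvq]; linarith⟩]
      · norm_num
      rintro ⟨q, hq, hpos⟩
      rw [hvol] at hpos
      nlinarith [mul_nonneg (hle q hq) h.le]

end Facet

end SimplicialPolytope

/-! ### Signed crossings of a ray with the boundary. -/

/-- A function on the line that is constant on punctured neighbourhoods of all points takes the
same values at any two points of local constancy. -/
theorem eq_of_eventually_punctured {X : Type*} {f : ℝ → X}
    (hf : ∀ t, ∃ c, ∀ᶠ s in 𝓝[≠] t, f s = c) {t₀ : ℝ} (h₀ : ∀ᶠ s in 𝓝 t₀, f s = f t₀) {c₁ : X}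
    (h₁ : ∀ᶠ s in atTop, f s = c₁) : f t₀ = c₁ := by
  choose c hc using hf
  -- The punctured values form a locally constant function even where `f` itself has an exceptional
  -- value.
  have hloc : IsLocallyConstant c := by
    rw [IsLocallyConstant.iff_eventually_eq]
    intro t
    obtain ⟨U, hUc, hU, htU⟩ := eventually_nhds_iff.1 (eventually_nhdsWithin_iff.1 (hc t))
    filter_upwards [hU.mem_nhds htU] with s hs
    by_cases hst : s = t
    · rw [hst]
    · have h1 : ∀ᶠ r in 𝓝[≠] s, r ∈ U ∩ {t}ᶜ :=
        mem_nhdsWithin_of_mem_nhds ((hU.inter isOpen_compl_singleton).mem_nhds ⟨hs, hst⟩)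
      obtain ⟨r, hr1, hr2⟩ := (h1.and (hc s)).exists
      rw [← hr2, hUc r hr1.1 hr1.2]
  have h2 : f t₀ = c t₀ := by
    obtain ⟨r, hr1, hr2⟩ := ((h₀.filter_mono nhdsWithin_le_nhds).and (hc t₀)).exists
    rw [← hr1, hr2]
  obtain ⟨T, hT⟩ := eventually_atTop.1 h₁
  have h3 : c (T + 1) = c₁ := by
    have : ∀ᶠ s in 𝓝[≠] (T + 1), T ≤ s :=
      mem_nhdsWithin_of_mem_nhds (Ici_mem_nhds (by linarith))
    obtain ⟨r, hr1, hr2⟩ := (this.and (hc (T + 1))).exists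
    rw [← hr2, hT r hr1]
  rw [h2, hloc.apply_eq_of_isPreconnected isPreconnected_univ (mem_univ t₀) (mem_univ (T + 1)), h3]

namespace SimplicialPolytope

variable {P : SimplicialPolytope d} {p u : Pt d}

theorem exists_facetBasis {F : Finset (Pt d)} (hF : F ∈ P.boundary.facets)
    (hp : p ∉ affineSpan ℝ (F : Set (Pt d))) :
    ∃ b : Module.Basis F ℝ (Pt d), ∀ f, b f = (f : Pt d) - p :=
  exists_coneBasis (P.card_of_facet F hF) (P.boundary.indep hF.1) hp

theorem mul_sum_repr_eq_one {F : Finset (Pt d)} {b : Module.Basis F ℝ (Pt d)}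
    (hb : ∀ f, b f = (f : Pt d) - p) {t : ℝ} (ht : p + t • u ∈ convexHull ℝ (F : Set (Pt d))) :
    t * ∑ f, b.repr u f = 1 := by
  have := ((mem_convexHull_iff_repr hb).1 ht).2
  rw [height_add_smul] at this
  linarith

/-- The line through `p` meets the facet at most once, so a hit at or after `s` means `s ≤ τ` for a
fixed `τ`; this condition is locally constant away from `τ`. -/
theorem eventually_hit_iff {F : Finset (Pt d)} {b : Module.Basis F ℝ (Pt d)}
    (hb : ∀ f, b f = (f : Pt d) - p) {t : ℝ} (ht : p + t • u ∉ convexHull ℝ (F : Set (Pt d))) :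
    ∀ᶠ s in 𝓝 t, ((∃ r ≥ s, p + r • u ∈ convexHull ℝ (F : Set (Pt d))) ↔
      ∃ r ≥ t, p + r • u ∈ convexHull ℝ (F : Set (Pt d))) := by
  by_cases h : ∃ τ : ℝ, p + τ • u ∈ convexHull ℝ (F : Set (Pt d))
  · obtain ⟨τ, hτ⟩ := h
    have huniq : ∀ r : ℝ, p + r • u ∈ convexHull ℝ (F : Set (Pt d)) → r = τ := fun r hr => by
      have h1 := mul_sum_repr_eq_one hb hr
      have h2 := mul_sum_repr_eq_one hb hτ
      exact mul_right_cancel₀ (right_ne_zero_of_mul_eq_one h1) (h1.trans h2.symm)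
    have hiff : ∀ s : ℝ, (∃ r ≥ s, p + r • u ∈ convexHull ℝ (F : Set (Pt d))) ↔ s ≤ τ := fun s =>
      ⟨fun ⟨r, hr, hrF⟩ => huniq r hrF ▸ hr, fun hs => ⟨τ, hs, hτ⟩⟩
    simp only [hiff]
    have hne : t ≠ τ := by rintro rfl; exact ht hτ
    rcases hne.lt_or_gt with h | h
    · filter_upwards [Iio_mem_nhds h] with s hs
      exact iff_of_true (le_of_lt hs) h.le
    · filter_upwards [Ioi_mem_nhds h] with s hs
      exact iff_of_false (not_le.2 hs) (not_le.2 h)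
  · exact Eventually.of_forall fun s =>
      iff_of_false (fun ⟨r, _, hr⟩ => h ⟨r, hr⟩) fun ⟨r, _, hr⟩ => h ⟨r, hr⟩

theorem eventually_mem_carrier_iff (P : SimplicialPolytope d) {t : ℝ}
    (ht : p + t • u ∉ frontier P.carrier) :
    ∀ᶠ s in 𝓝 t, (p + s • u ∈ P.carrier ↔ p + t • u ∈ P.carrier) := by
  have hcont : Continuous fun s : ℝ => p + s • u := by fun_prop
  by_cases h : p + t • u ∈ P.carrier
  · have hi : p + t • u ∈ interior P.carrier := by
      by_contra hi
      exact ht (P.isClosed_carrier.frontier_eq ▸ ⟨h, hi⟩)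
    filter_upwards [hcont.continuousAt.eventually (isOpen_interior.mem_nhds hi)] with s hs
    exact iff_of_true (interior_subset hs) h
  · filter_upwards [hcont.continuousAt.eventually (P.isClosed_carrier.isOpen_compl.mem_nhds h)]
      with s hs
    exact iff_of_false hs h

theorem eventually_notMem_carrier (P : SimplicialPolytope d) (hu : u ≠ 0) :
    ∀ᶠ t : ℝ in atTop, p + t • u ∉ P.carrier := by
  obtain ⟨R, hR⟩ := P.isCompact.isBounded.subset_closedBall p
  filter_upwards [eventually_gt_atTop (|R| / ‖u‖), eventually_ge_atTop 0] with t ht ht0 hmem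
  have h1 := hR hmem
  rw [Metric.mem_closedBall, dist_self_add_left, norm_smul, Real.norm_eq_abs, abs_of_nonneg ht0] at h1
  rw [div_lt_iff₀ (norm_pos_iff.2 hu)] at ht
  linarith [le_abs_self R]

open Classical in
/-- A ray that avoids the ridges of the polytope crosses the facets with total sign one or zero,
according to whether it starts inside or outside the polytope. -/
theorem sum_faceSign_hit (hp : ∀ F ∈ P.boundary.facets, p ∉ affineSpan ℝ (F : Set (Pt d)))
    (hu : u ≠ 0) (hridge : ∀ F ∈ P.boundary.facets, ∀ f ∈ F, ∀ t : ℝ,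
      p + t • u ∉ convexHull ℝ ((F.erase f : Finset (Pt d)) : Set (Pt d)))
    {t₀ : ℝ} (ht₀ : 0 ≤ t₀) (hfr : p + t₀ • u ∉ frontier P.carrier) :
    ∑ F ∈ P.finite_facets.toFinset, P.faceSign F p *
      (if ∃ r ≥ t₀, p + r • u ∈ convexHull ℝ (F : Set (Pt d)) then 1 else 0) =
    if p + t₀ • u ∈ P.carrier then 1 else 0 := by
  let g : ℝ → ℤ := fun t => if p + t • u ∈ P.carrier then 1 else 0
  let A : Finset (Pt d) → ℝ → ℤ := fun F t =>
    P.faceSign F p * (if ∃ r ≥ t, p + r • u ∈ convexHull ℝ (F : Set (Pt d)) then 1 else 0)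
  -- The defect between membership and the signed number of facets still ahead. It vanishes far out
  -- on the ray, and it remains to see that crossings do not change it.
  let h : ℝ → ℤ := fun t => g t - ∑ F ∈ P.finite_facets.toFinset, A F t
  have hA : ∀ F ∈ P.boundary.facets, ∀ t, p + t • u ∉ convexHull ℝ (F : Set (Pt d)) →
      ∀ᶠ s in 𝓝 t, A F s = A F t := fun F hF t ht => by
    obtain ⟨b, hb⟩ := exists_facetBasis hF (hp F hF)
    filter_upwards [eventually_hit_iff hb ht] with s hs
    simp only [A, hs]
  have hg : ∀ t, p + t • u ∉ frontier P.carrier → ∀ᶠ s in 𝓝 t, g s = g t := fun t ht => by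
    filter_upwards [P.eventually_mem_carrier_iff ht] with s hs
    simp only [g, hs]
  have hoff : ∀ t, p + t • u ∉ frontier P.carrier → ∀ᶠ s in 𝓝 t, h s = h t := fun t ht => by
    have h1 : ∀ᶠ s in 𝓝 t, ∀ F ∈ P.finite_facets.toFinset, A F s = A F t :=
      (eventually_all_finset _).2 fun F hF => by
        have hF' := P.finite_facets.mem_toFinset.1 hF
        exact hA F hF' t fun hc => ht (convexHull_subset_frontier hF' hc)
    filter_upwards [h1, hg t ht] with s hs1 hs2
    simp only [h, hs2, Finset.sum_congr rfl hs1]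
  have hon : ∀ t > 0, p + t • u ∈ frontier P.carrier → ∃ c, ∀ᶠ s in 𝓝[≠] t, h s = c := by
    intro t ht0 ht
    rw [frontier_eq] at ht
    simp only [mem_iUnion] at ht
    obtain ⟨F, hF, htF⟩ := ht
    obtain ⟨b, hb⟩ := exists_facetBasis hF (hp F hF)
    have hS := mul_sum_repr_eq_one hb htF
    have hyF := (mem_convexHull_iff_repr hb).1 htF
    -- Avoiding the ridges forces the crossing into the relative interior of one facet.
    have hpos : ∀ f, 0 < b.repr (p + t • u - p) f := fun f => by
      refine (hyF.1 f).lt_of_ne fun h0 => hridge F hF f f.2 t ?_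
      rw [mem_convexHull_of_subset_iff hb (Finset.erase_subset _ _)]
      refine ⟨hyF.1, hyF.2, fun g hg => ?_⟩
      have : g = f := by
        by_contra hne
        exact hg (Finset.mem_erase.2 ⟨fun hc => hne (Subtype.ext hc), g.2⟩)
      rw [this, ← h0]
    have hht : ∀ s, t * height b p (p + s • u) = s - t := fun s => by
      rw [height_add_smul]; linear_combination s * hS
    have hAF : ∀ s, A F s = P.faceSign F p * if s ≤ t then 1 else 0 := fun s => by
      simp only [A]
      congr 2
      refine propext ⟨fun ⟨r, hr, hrF⟩ => ?_, fun hs => ⟨t, hs, htF⟩⟩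
      have : r = t := mul_right_cancel₀ (right_ne_zero_of_mul_eq_one hS)
        ((mul_sum_repr_eq_one hb hrF).trans hS.symm)
      exact this ▸ hr
    have hcont : Continuous fun s : ℝ => p + s • u := by fun_prop
    -- For sign `1` the ray leaves the polytope and both terms drop from `1` to `0`; for sign `-1`
    -- it enters, and both increase by `1`.
    have hgF : ∃ c, ∀ᶠ s in 𝓝[≠] t, g s - A F s = c := by
      rcases faceSign_cases hF hb with ⟨hs, -, -, hin⟩ | ⟨hs, -, -, hout⟩
      · refine ⟨0, ?_⟩
        filter_upwards [(hcont.continuousAt.eventually (hin _ hpos hyF.2)).filter_mono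
          nhdsWithin_le_nhds, self_mem_nhdsWithin] with s hs1 hst
        rw [hAF, hs]
        rcases lt_or_gt_of_ne hst with hlt | hlt
        · have : height b p (p + s • u) < 0 := by
            by_contra hc
            nlinarith [hht s, mul_nonneg ht0.le (not_lt.1 hc)]
          simp [g, interior_subset (hs1.1 this), hlt.le]
        · have : 0 < height b p (p + s • u) := by
            by_contra hc
            nlinarith [hht s, mul_nonneg ht0.le (neg_nonneg.2 (not_lt.1 hc))]
          simp [g, hs1.2 this, not_le.2 hlt]
      · refine ⟨1, ?_⟩
        filter_upwards [(hcont.continuousAt.eventually (hout _ hpos hyF.2)).filter_mono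
          nhdsWithin_le_nhds, self_mem_nhdsWithin] with s hs1 hst
        rw [hAF, hs]
        rcases lt_or_gt_of_ne hst with hlt | hlt
        · have : height b p (p + s • u) < 0 := by
            by_contra hc
            nlinarith [hht s, mul_nonneg ht0.le (not_lt.1 hc)]
          simp [g, hs1.1 this, hlt.le]
        · have : 0 < height b p (p + s • u) := by
            by_contra hc
            nlinarith [hht s, mul_nonneg ht0.le (neg_nonneg.2 (not_lt.1 hc))]
          simp [g, interior_subset (hs1.2 this), not_le.2 hlt]
    obtain ⟨c, hc⟩ := hgF
    have h1 : ∀ᶠ s in 𝓝 t, ∀ G ∈ P.finite_facets.toFinset.erase F, A G s = A G t :=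
      (eventually_all_finset _).2 fun G hG => by
        rw [Finset.mem_erase, Set.Finite.mem_toFinset] at hG
        exact hA G hG.2 t fun hc => hG.1 (eq_of_mem_convexHull_facet hF hb hpos hyF.2 hG.2 hc)
    refine ⟨c - ∑ G ∈ P.finite_facets.toFinset.erase F, A G t, ?_⟩
    filter_upwards [hc, h1.filter_mono nhdsWithin_le_nhds] with s hs1 hs2
    simp only [h]
    rw [← Finset.add_sum_erase _ _ (P.finite_facets.mem_toFinset.2 hF), ← hs1,
      Finset.sum_congr rfl hs2]
    ring
  -- Freezing the defect before `t₀` restricts the argument to `t > t₀ ≥ 0`, as the crossing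
  -- analysis needs positive parameters.
  have hmax : Continuous fun t : ℝ => max t t₀ := by fun_prop
  have hzero : h t₀ = 0 := by
    have := eq_of_eventually_punctured (f := fun t => h (max t t₀)) (t₀ := t₀) (c₁ := 0) ?_ ?_ ?_
    · simpa using this
    · intro t
      rcases lt_trichotomy t t₀ with hlt | rfl | hlt
      · refine ⟨h t₀, (Eventually.filter_mono nhdsWithin_le_nhds ?_)⟩
        filter_upwards [Iio_mem_nhds hlt] with s hs
        rw [max_eq_right (le_of_lt hs)]
      · refine ⟨h t, (Eventually.filter_mono nhdsWithin_le_nhds ?_)⟩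
        have := hmax.continuousAt (x := t)
        rw [ContinuousAt, max_self] at this
        exact this.eventually (hoff t hfr)
      · have hev : ∃ c, ∀ᶠ s in 𝓝[≠] t, h s = c := by
          by_cases hc : p + t • u ∈ frontier P.carrier
          · exact hon t (ht₀.trans_lt hlt) hc
          · exact ⟨_, (hoff t hc).filter_mono nhdsWithin_le_nhds⟩
        obtain ⟨c, hc⟩ := hev
        refine ⟨c, ?_⟩
        filter_upwards [hc, mem_nhdsWithin_of_mem_nhds (Ioi_mem_nhds hlt)] with s hs1 hs2
        rw [max_eq_left (le_of_lt hs2), hs1]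
    · have := hmax.continuousAt (x := t₀)
      rw [ContinuousAt, max_self] at this
      simpa using this.eventually (hoff t₀ hfr)
    · obtain ⟨T, hT⟩ := eventually_atTop.1 (P.eventually_notMem_carrier (p := p) hu)
      filter_upwards [eventually_ge_atTop T, eventually_ge_atTop t₀] with t ht1 ht2
      rw [max_eq_left ht2]
      simp only [h, g, A, if_neg (hT t ht1), zero_sub, neg_eq_zero]
      refine Finset.sum_eq_zero fun F hF => ?_
      rw [if_neg, mul_zero]
      rintro ⟨r, hr, hrF⟩
      exact hT r (ht1.trans hr) (P.isClosed_carrier.frontier_subset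
        (convexHull_subset_frontier (P.finite_facets.mem_toFinset.1 hF) hrF))
  exact (sub_eq_zero.1 hzero).symm

end SimplicialPolytope

/-! ### Generic apices and cancellation around ridges. -/

theorem affineSpan_ne_top_of_card_le {s : Finset (Pt d)} (hs : s.card ≤ d) :
    affineSpan ℝ (s : Set (Pt d)) ≠ ⊤ := by
  intro h
  rcases s.eq_empty_or_nonempty with rfl | hne
  · simp at h
  · have h1 : vectorSpan ℝ (s : Set (Pt d)) = ⊤ := by
      rw [← direction_affineSpan, h, AffineSubspace.direction_top]
    have h2 := finrank_vectorSpan_image_finset_le ℝ (id : Pt d → Pt d) s (n := s.card - 1)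
      (by have := hne.card_pos; omega)
    rw [Finset.image_id, h1, finrank_top, finrank_euclideanSpace_fin] at h2
    have := hne.card_pos
    omega

theorem ae_notMem_affineSpan {S : Set (Finset (Pt d))} (hS : S.Finite)
    (h : ∀ s ∈ S, s.card ≤ d) :
    ∀ᵐ x : Pt d, ∀ s ∈ S, x ∉ affineSpan ℝ (s : Set (Pt d)) := by
  rw [ae_ball_iff hS.countable]
  intro s hs
  exact measure_eq_zero_iff_ae_notMem.1
    (Measure.addHaar_affineSubspace volume _ (affineSpan_ne_top_of_card_le (h s hs)))

theorem mem_affineSpan_insert_erase [DecidableEq (Pt d)] {F : Finset (Pt d)} {p : Pt d}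
    {b : Module.Basis F ℝ (Pt d)} (hb : ∀ f, b f = (f : Pt d) - p) {y : Pt d} {f : F}
    (hy : b.repr (y - p) f = 0) :
    y ∈ affineSpan ℝ ((insert p (F.erase f) : Finset (Pt d)) : Set (Pt d)) := by
  set A := affineSpan ℝ ((insert p (F.erase f) : Finset (Pt d)) : Set (Pt d))
  have hp : p ∈ A := subset_affineSpan _ _ (by simp)
  rw [eq_add_sum_repr hb y, add_comm]
  refine AffineSubspace.vadd_mem_of_mem_direction (Submodule.sum_mem _ fun g _ => ?_) hp
  by_cases hg : g = f
  · rw [hg, hy, zero_smul]; exact Submodule.zero_mem _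
  · refine Submodule.smul_mem _ _ (AffineSubspace.vsub_mem_direction (subset_affineSpan _ _ ?_) hp)
    simp only [Finset.coe_insert, Finset.coe_erase]
    exact Or.inr ⟨g.2, fun h => hg (Subtype.ext h)⟩

theorem repr_sum_sub [DecidableEq (Pt d)] {F R : Finset (Pt d)} {p : Pt d}
    {b : Module.Basis F ℝ (Pt d)}
    (hb : ∀ f, b f = (f : Pt d) - p) (hR : R ⊆ F) (f : F) :
    b.repr (∑ r ∈ R, (r - p)) f = if (f : Pt d) ∈ R then 1 else 0 := by
  have h1 : ∀ r ∈ R, b.repr (r - p) f = if r = f then 1 else 0 := fun r hr => by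
    rw [repr_sub_vertex hb ⟨r, hR hr⟩ f]
    simp only [Subtype.ext_iff]
  rw [map_sum, Finsupp.coe_finsetSum, Finset.sum_apply, Finset.sum_congr rfl h1,
    Finset.sum_ite_eq']

/-- A direction in the open cone reaches the facet after scaling by the inverse of its coordinate
sum. Nonvanishing coordinates exclude the boundary of the cone. -/
theorem exists_hit_iff {F : Finset (Pt d)} {p u : Pt d} {b : Module.Basis F ℝ (Pt d)}
    (hF : F.Nonempty) (hb : ∀ f, b f = (f : Pt d) - p) (hu : ∀ f, b.repr u f ≠ 0) :
    (∃ r ≥ (0 : ℝ), p + r • u ∈ convexHull ℝ (F : Set (Pt d))) ↔ ∀ f, 0 < b.repr u f := by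
  have hrep : ∀ (r : ℝ) f, b.repr (p + r • u - p) f = r * b.repr u f := fun r f => by simp
  constructor
  · rintro ⟨r, hr, hrF⟩ f
    have h1 := SimplicialPolytope.mul_sum_repr_eq_one hb hrF
    have h2 := ((mem_convexHull_iff_repr hb).1 hrF).1 f
    have hr' : 0 < r := hr.lt_of_ne fun h => by rw [← h] at h1; simp at h1
    rw [hrep] at h2
    exact (nonneg_of_mul_nonneg_right h2 hr').lt_of_ne (hu f).symm
  · intro h
    have hS : 0 < ∑ f, b.repr u f :=
      Finset.sum_pos (fun f _ => h f) ⟨⟨_, hF.choose_spec⟩, Finset.mem_univ _⟩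
    refine ⟨(∑ f, b.repr u f)⁻¹, by positivity, (mem_convexHull_iff_repr hb).2
      ⟨fun f => ?_, ?_⟩⟩
    · rw [hrep]; exact mul_nonneg (by positivity) (h f).le
    · rw [height_add_smul, inv_mul_cancel₀ hS.ne', sub_self]

/-- The barycenter of a finite set of points. -/
noncomputable def barycenter (R : Finset (Pt d)) : Pt d := (R.card : ℝ)⁻¹ • ∑ r ∈ R, r

namespace SimplicialPolytope

variable {P : SimplicialPolytope d} {p : Pt d}

open Classical in
variable (P p) in
/-- A point in general position with respect to the facets and ridges of a polytope. -/
def IsGenericApex : Prop :=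
  (∀ F ∈ P.boundary.facets, p ∉ affineSpan ℝ (F : Set (Pt d))) ∧
  ∀ F ∈ P.boundary.facets, ∀ f ∈ F, ∀ G ∈ P.boundary.facets, ∀ g ∈ G,
    p ∉ affineSpan ℝ ((insert (barycenter (F.erase f)) (G.erase g) : Finset (Pt d)) : Set (Pt d))

theorem exists_isGenericApex (hd : 1 ≤ d) (P : SimplicialPolytope d) :
    ∃ p, P.IsGenericApex p := by
  classical
  have hfin := P.finite_facets
  let V : Finset (Pt d) := hfin.toFinset.biUnion id
  have hV : ∀ F ∈ P.boundary.facets, F ⊆ V := fun F hF =>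
    Finset.subset_biUnion_of_mem id (hfin.mem_toFinset.2 hF)
  let S : Set (Finset (Pt d)) := P.boundary.facets ∪
    image2 (fun A B : Finset (Pt d) × Pt d => insert (barycenter (A.1.erase A.2)) (B.1.erase B.2))
      {A | A.1 ∈ P.boundary.facets ∧ A.2 ∈ A.1} {A | A.1 ∈ P.boundary.facets ∧ A.2 ∈ A.1}
  have hflag : {A : Finset (Pt d) × Pt d | A.1 ∈ P.boundary.facets ∧ A.2 ∈ A.1}.Finite :=
    (hfin.prod V.finite_toSet).subset fun A hA => ⟨hA.1, hV _ hA.1 hA.2⟩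
  have hS : S.Finite := hfin.union (hflag.image2 _ hflag)
  have hcard : ∀ s ∈ S, s.card ≤ d := by
    rintro s (hs | ⟨A, hA, B, hB, rfl⟩)
    · exact (P.card_of_facet s hs).le
    · refine (Finset.card_insert_le _ _).trans ?_
      rw [Finset.card_erase_of_mem hB.2, P.card_of_facet _ hB.1]
      omega
  obtain ⟨p, hp⟩ := (ae_notMem_affineSpan hS hcard).exists
  exact ⟨p, fun F hF => hp F (Or.inl hF), fun F hF f hf G hG g hg =>
    hp _ (Or.inr ⟨(F, f), ⟨hF, hf⟩, (G, g), ⟨hG, hg⟩, rfl⟩)⟩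

open Classical in
/-- A facet whose closed cone has the cone direction of the barycenter of a ridge on its boundary
contains that ridge. -/
theorem IsGenericApex.eq_erase (hp : P.IsGenericApex p) {F₀ : Finset (Pt d)}
    (hF₀ : F₀ ∈ P.boundary.facets) {f₀ : Pt d} (hf₀ : f₀ ∈ F₀) {F : Finset (Pt d)}
    (hF : F ∈ P.boundary.facets) {b : Module.Basis F ℝ (Pt d)} (hb : ∀ f, b f = (f : Pt d) - p)
    (hnonneg : ∀ f, 0 ≤ b.repr (∑ r ∈ F₀.erase f₀, (r - p)) f) {q : F}
    (hq : b.repr (∑ r ∈ F₀.erase f₀, (r - p)) q = 0) : F.erase q = F₀.erase f₀ := by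
  set R := F₀.erase f₀
  set z := ∑ r ∈ R, (r - p)
  have hRcard : R.card = d - 1 := by
    rw [Finset.card_erase_of_mem hf₀, P.card_of_facet _ hF₀]
  have hFcard : (F.erase q).card = d - 1 := by
    rw [Finset.card_erase_of_mem q.2, P.card_of_facet _ hF]
  -- For `d = 1` the ridges are empty and have no barycenter to work with.
  rcases R.eq_empty_or_nonempty with hR | hR
  · rw [hR, ← Finset.card_eq_zero, hFcard, ← hRcard, hR, Finset.card_empty]
  have hm : (0 : ℝ) < R.card := Nat.cast_pos.2 hR.card_pos
  set ρ := barycenter R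
  have hz : z = (R.card : ℝ) • (ρ - p) := by
    simp only [z, ρ, barycenter, Finset.sum_sub_distrib, smul_sub, smul_smul,
      mul_inv_cancel₀ hm.ne', one_smul, Finset.sum_const, Nat.cast_smul_eq_nsmul]
  obtain ⟨b₀, hb₀⟩ := exists_facetBasis hF₀ (hp.1 F₀ hF₀)
  have hRF : R ⊆ F₀ := Finset.erase_subset _ _
  have hρrepr : ∀ f, b₀.repr (ρ - p) f = (R.card : ℝ)⁻¹ * if (f : Pt d) ∈ R then 1 else 0 := by
    intro f
    rw [← repr_sum_sub hb₀ hRF f, show ρ - p = (R.card : ℝ)⁻¹ • z by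
      rw [hz, smul_smul, inv_mul_cancel₀ hm.ne', one_smul]]
    simp [z]
  have hρ : ρ ∈ convexHull ℝ (R : Set (Pt d)) := by
    refine Finset.mem_convexHull'.2 ⟨fun _ => (R.card : ℝ)⁻¹, fun _ _ => by positivity, ?_, ?_⟩
    · simp [hm.ne']
    · rw [← Finset.smul_sum]; rfl
  have hz0 : z ≠ 0 := by
    intro h
    rw [hz, smul_eq_zero, sub_eq_zero] at h
    refine hp.1 F₀ hF₀ ((h.resolve_left hm.ne') ▸ ?_)
    exact convexHull_subset_affineSpan _ (convexHull_mono (Finset.coe_subset.2 hRF) hρ)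
  have hS : 0 < ∑ f, b.repr z f := by
    refine (Finset.sum_nonneg fun f _ => hnonneg f).lt_of_ne fun h => hz0 ?_
    have := (Finset.sum_eq_zero_iff_of_nonneg fun f _ => hnonneg f).1 h.symm
    refine b.repr.map_eq_zero_iff.1 (Finsupp.ext fun f => this f (Finset.mem_univ f))
  set a := (∑ f, b.repr z f)⁻¹
  have ha : 0 < a := by positivity
  have hy : p + a • z ∈ convexHull ℝ ((F.erase q : Finset (Pt d)) : Set (Pt d)) := by
    have hrep : ∀ f, b.repr (p + a • z - p) f = a * b.repr z f := fun f => by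
      rw [add_sub_cancel_left]; simp
    refine (mem_convexHull_of_subset_iff hb (Finset.erase_subset _ _)).2 ⟨fun f => ?_, ?_, ?_⟩
    · rw [hrep]; exact mul_nonneg ha.le (hnonneg f)
    · rw [height_add_smul, inv_mul_cancel₀ hS.ne', sub_self]
    · intro f hf
      have : f = q := by
        by_contra hne
        exact hf (Finset.mem_erase.2 ⟨fun hc => hne (Subtype.ext hc), f.2⟩)
      rw [hrep, this, hq, mul_zero]
  -- The ray through the barycenter `ρ` meets the hull of `F.erase q`. If it does so at `ρ`, the
  -- complex condition identifies the two ridges, as `ρ` has positive weight on each vertex of `R`.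
  -- Otherwise `p` is on the line joining two points of the span excluded by genericity.
  by_cases hyρ : p + a • z = ρ
  · rw [hyρ] at hy
    have hne : (F.erase q).Nonempty := Finset.card_pos.1 (by rw [hFcard, ← hRcard]; exact hR.card_pos)
    have h := P.boundary.inter_subset_convexHull (P.boundary.down_closed hF₀.1 hRF hR)
      (P.boundary.down_closed hF.1 (Finset.erase_subset _ _) hne) ⟨hρ, hy⟩
    rw [← Finset.coe_inter, mem_convexHull_of_subset_iff hb₀
      (Finset.inter_subset_left.trans hRF)] at h
    refine (Finset.eq_of_subset_of_card_le (fun r hr => ?_) (by rw [hRcard, hFcard])).symm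
    by_contra hc
    have := h.2.2 ⟨r, hRF hr⟩ fun hc' => hc (Finset.mem_inter.1 hc').2
    rw [hρrepr, if_pos hr] at this
    simp [hm.ne'] at this
  · exfalso
    apply hp.2 F₀ hF₀ f₀ hf₀ F hF q q.2
    have h1 : ρ ∈ affineSpan ℝ ((insert ρ (F.erase q) : Finset (Pt d)) : Set (Pt d)) :=
      subset_affineSpan _ _ (by simp)
    have h2 : p + a • z ∈ affineSpan ℝ ((insert ρ (F.erase q) : Finset (Pt d)) : Set (Pt d)) :=
      affineSpan_mono _ (Finset.coe_subset.2 (Finset.subset_insert _ _))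
        (convexHull_subset_affineSpan _ hy)
    have hc : 1 - a * R.card ≠ 0 := fun h => hyρ (by
      rw [hz, smul_smul, ← sub_eq_zero.1 h, one_smul, add_sub_cancel])
    have h3 := AffineMap.lineMap_mem (1 - a * R.card)⁻¹ h1 h2
    have h4 : AffineMap.lineMap ρ (p + a • z) (1 - a * (R.card : ℝ))⁻¹ = p := by
      rw [AffineMap.lineMap_apply_module', show p + a • z - ρ = (1 - a * R.card) • (p - ρ) by
        rw [hz]; module, smul_smul, inv_mul_cancel₀ hc, one_smul, sub_add_cancel]
    rwa [h4] at h3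

theorem eventually_add_mul_ne_zero {c m : ℝ} (hm : m ≠ 0) :
    ∀ᶠ δ in 𝓝[>] (0 : ℝ), c + δ * m ≠ 0 := by
  by_cases hc : c = 0
  · filter_upwards [self_mem_nhdsWithin] with δ hδ
    rw [hc, zero_add]
    exact mul_ne_zero (ne_of_gt hδ) hm
  · have h : Continuous fun δ : ℝ => c + δ * m := by fun_prop
    exact (h.continuousAt.eventually_ne (by simpa using hc)).filter_mono nhdsWithin_le_nhds

theorem eventually_add_mul_pos {c : ℝ} (hc : 0 < c) (m : ℝ) :
    ∀ᶠ δ in 𝓝[>] (0 : ℝ), 0 < c + δ * m := by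
  have h : Continuous fun δ : ℝ => c + δ * m := by fun_prop
  exact (h.continuousAt.eventually_const_lt (by simpa using hc)).filter_mono nhdsWithin_le_nhds

theorem eventually_add_mul_neg {c : ℝ} (hc : c < 0) (m : ℝ) :
    ∀ᶠ δ in 𝓝[>] (0 : ℝ), c + δ * m < 0 := by
  have h : Continuous fun δ : ℝ => c + δ * m := by fun_prop
  exact (h.continuousAt.eventually_lt_const (by simpa using hc)).filter_mono nhdsWithin_le_nhds

open Classical in
/-- The facets around a ridge cancel: the boundary chain of a polytope is a cycle. -/
theorem IsGenericApex.sum_faceSign_ridge (hd : 1 ≤ d) (hp : P.IsGenericApex p)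
    {R : Finset (Pt d)} (L : Pt d →ᵃ[ℝ] ℝ) (hLp : L p = 0) (hLR : ∀ r ∈ R, L r = 0) :
    ∑ F ∈ P.finite_facets.toFinset, P.faceSign F p *
      ∑ q ∈ F, (if F.erase q = R then sgn (L q) else 0) = 0 := by
  by_cases hex : ∃ F₀ ∈ P.boundary.facets, ∃ f₀ ∈ F₀, F₀.erase f₀ = R
  swap
  · refine Finset.sum_eq_zero fun F hF => ?_
    rw [Finset.sum_eq_zero, mul_zero]
    intro q hq
    rw [if_neg]
    exact fun h => hex ⟨F, P.finite_facets.mem_toFinset.1 hF, q, hq, h⟩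
  obtain ⟨F₀, hF₀, f₀, hf₀, rfl⟩ := hex
  set R := F₀.erase f₀
  set z := ∑ r ∈ R, (r - p)
  -- The perturbation `n = x - p` is chosen to have no zero coordinate in any facet basis, so the
  -- rays in directions `z + δ n` and `z - δ n` avoid all ridges for small `δ > 0`.
  obtain ⟨x, hx⟩ : ∃ x : Pt d, ∀ F ∈ P.boundary.facets, ∀ f ∈ F,
      x ∉ affineSpan ℝ ((insert p (F.erase f) : Finset (Pt d)) : Set (Pt d)) := by
    let S : Set (Finset (Pt d)) := ⋃ F ∈ P.boundary.facets, (fun f => insert p (F.erase f)) '' F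
    have hS : S.Finite := P.finite_facets.biUnion fun F _ => F.finite_toSet.image _
    have hcard : ∀ s ∈ S, s.card ≤ d := by
      intro s hs
      simp only [S, mem_iUnion] at hs
      obtain ⟨F, hF, f, hf, rfl⟩ := hs
      refine (Finset.card_insert_le _ _).trans ?_
      rw [Finset.card_erase_of_mem hf, P.card_of_facet _ hF]
      omega
    obtain ⟨x, hx⟩ := (ae_notMem_affineSpan hS hcard).exists
    exact ⟨x, fun F hF f hf => hx _ (mem_biUnion hF ⟨f, hf, rfl⟩)⟩
  set n := x - p
  have hn : ∀ F ∈ P.boundary.facets, ∀ b : Module.Basis F ℝ (Pt d),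
      (∀ f, b f = (f : Pt d) - p) → ∀ f, b.repr n f ≠ 0 := fun F hF b hb f h =>
    hx F hF f f.2 (mem_affineSpan_insert_erase hb h)
  let hit : Finset (Pt d) → Pt d → ℤ := fun F u =>
    if ∃ r ≥ (0 : ℝ), p + r • u ∈ convexHull ℝ (F : Set (Pt d)) then 1 else 0
  have hreg : ∀ᶠ δ in 𝓝[>] (0 : ℝ), ∀ F ∈ P.finite_facets.toFinset,
      ∀ b : Module.Basis F ℝ (Pt d), (∀ f, b f = (f : Pt d) - p) → ∀ f,
        b.repr (z + δ • n) f ≠ 0 ∧ b.repr (z + δ • -n) f ≠ 0 := by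
    refine (eventually_all_finset _).2 fun F hF => ?_
    rw [Set.Finite.mem_toFinset] at hF
    obtain ⟨b, hb⟩ := exists_facetBasis hF (hp.1 F hF)
    have : ∀ᶠ δ in 𝓝[>] (0 : ℝ), ∀ f,
        b.repr z f + δ * b.repr n f ≠ 0 ∧ b.repr z f + δ * -b.repr n f ≠ 0 :=
      eventually_all.2 fun f => (eventually_add_mul_ne_zero (hn F hF b hb f)).and
        (eventually_add_mul_ne_zero (neg_ne_zero.2 (hn F hF b hb f)))
    filter_upwards [this] with δ hδ b' hb'
    obtain rfl : b' = b := Module.Basis.eq_of_apply_eq fun f => by rw [hb, hb']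
    intro f
    simpa using hδ f
  have hsum : ∀ u, (∀ F ∈ P.finite_facets.toFinset,
      ∀ b : Module.Basis F ℝ (Pt d), (∀ f, b f = (f : Pt d) - p) → ∀ f, b.repr u f ≠ 0) →
      ∑ F ∈ P.finite_facets.toFinset, P.faceSign F p * hit F u =
        if p ∈ P.carrier then 1 else 0 := by
    intro u hu
    have hu0 : u ≠ 0 := by
      obtain ⟨b, hb⟩ := exists_facetBasis hF₀ (hp.1 F₀ hF₀)
      rintro rfl
      exact hu F₀ (P.finite_facets.mem_toFinset.2 hF₀) b hb ⟨f₀, hf₀⟩ (by simp)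
    have := sum_faceSign_hit (P := P) (p := p) (u := u) (t₀ := 0) hp.1 hu0 ?_ le_rfl ?_
    · simp only [zero_smul, add_zero] at this
      exact this
    · intro F hF f hf t ht
      obtain ⟨b, hb⟩ := exists_facetBasis hF (hp.1 F hF)
      have h1 := (mem_convexHull_of_subset_iff hb (Finset.erase_subset _ _)).1 ht
      have h2 := h1.2.2 ⟨f, hf⟩ (by simp)
      rw [add_sub_cancel_left] at h2
      simp only [map_smul, Finsupp.coe_smul, Pi.smul_apply, smul_eq_mul] at h2
      rcases mul_eq_zero.1 h2 with h3 | h3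
      · have h4 := h1.2.1
        rw [height_add_smul, h3] at h4
        norm_num at h4
      · exact hu F (P.finite_facets.mem_toFinset.2 hF) b hb ⟨f, hf⟩ h3
    · rw [zero_smul, add_zero, frontier_eq]
      simp only [mem_iUnion, not_exists]
      exact fun F hF h => hp.1 F hF (convexHull_subset_affineSpan _ h)
  -- Only facets containing the ridge can be hit by one of the two rays and missed by the other. For
  -- such a facet the jump is the sign of the coordinate of `n` at the extra vertex `q`, and `L (p +
  -- n)` is this coordinate times `L q`.
  have hjump : ∀ᶠ δ in 𝓝[>] (0 : ℝ), ∀ F ∈ P.finite_facets.toFinset,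
      (hit F (z + δ • n) - hit F (z + δ • -n)) * sgn (L (p + n)) =
        ∑ q ∈ F, (if F.erase q = R then sgn (L q) else 0) := by
    refine (eventually_all_finset _).2 fun F hF => ?_
    have hF' := P.finite_facets.mem_toFinset.1 hF
    have hFne := P.boundary.nonempty_of_mem_faces hF'.1
    obtain ⟨b, hb⟩ := exists_facetBasis hF' (hp.1 F hF')
    have hrep : ∀ (m : Pt d) (δ : ℝ) f, b.repr (z + δ • m) f = b.repr z f + δ * b.repr m f :=
      fun m δ f => by simp
    by_cases hq : ∃ q ∈ F, F.erase q = R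
    · obtain ⟨q, hq, hqR⟩ := hq
      have hsumq : ∑ q ∈ F, (if F.erase q = R then sgn (L q) else 0) = sgn (L q) := by
        rw [Finset.sum_eq_single q, if_pos hqR]
        · intro q' hq' hne
          rw [if_neg]
          intro h
          have : q ∈ F.erase q' := Finset.mem_erase.2 ⟨hne.symm, hq⟩
          rw [h, ← hqR] at this
          simp at this
        · exact fun h => absurd hq h
      have hz : ∀ f : F, b.repr z f = if (f : Pt d) ∈ R then 1 else 0 :=
        repr_sum_sub hb (by rw [← hqR]; exact Finset.erase_subset _ _)
      have hzq : b.repr z ⟨q, hq⟩ = 0 := by rw [hz, if_neg]; rw [← hqR]; simp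
      have hL : L (p + n) = b.repr n ⟨q, hq⟩ * L q := by
        have h1 : ∀ y, L.linear (y - p) = L y := fun y => by
          rw [← vsub_eq_sub, L.linearMap_vsub, hLp]; simp
        have h2 : L (p + n) = L.linear n := by rw [← h1, add_sub_cancel_left]
        rw [h2]
        conv_lhs => rw [← b.sum_repr n]
        simp only [map_sum, map_smul, hb, h1, smul_eq_mul]
        rw [Finset.sum_eq_single ⟨q, hq⟩]
        · intro f _ hf
          rw [hLR f, mul_zero]
          rw [← hqR]
          exact Finset.mem_erase.2 ⟨fun h => hf (Subtype.ext h), f.2⟩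
        · simp
      have hother : ∀ᶠ δ in 𝓝[>] (0 : ℝ), ∀ f, f ≠ ⟨q, hq⟩ →
          0 < b.repr (z + δ • n) f ∧ 0 < b.repr (z + δ • -n) f := by
        refine eventually_all.2 fun f => eventually_imp_distrib_left.2 fun hf => ?_
        have hfz : 0 < b.repr z f := by
          rw [hz, if_pos]
          · norm_num
          · rw [← hqR]; exact Finset.mem_erase.2 ⟨fun h => hf (Subtype.ext h), f.2⟩
        simp only [hrep]
        exact (eventually_add_mul_pos hfz _).and (eventually_add_mul_pos hfz _)
      filter_upwards [hother, hreg, self_mem_nhdsWithin] with δ h1 h2 hδ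
      have hδ' : 0 < δ := hδ
      have hhit : ∀ m : Pt d, (∀ f, b.repr (z + δ • m) f ≠ 0) →
          (∀ f, f ≠ ⟨q, hq⟩ → 0 < b.repr (z + δ • m) f) →
          hit F (z + δ • m) = if 0 < b.repr m ⟨q, hq⟩ then 1 else 0 := by
        intro m hm0 hm
        simp only [hit, exists_hit_iff hFne hb hm0]
        congr 1
        refine propext ⟨fun h => ?_, fun h f => ?_⟩
        · have := h ⟨q, hq⟩
          rw [hrep, hzq, zero_add] at this
          exact (mul_pos_iff_of_pos_left hδ').1 this
        · by_cases hf : f = ⟨q, hq⟩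
          · rw [hf, hrep, hzq, zero_add]; exact mul_pos hδ' h
          · exact hm f hf
      rw [hsumq, hhit n (fun f => (h2 F hF b hb f).1) fun f hf => (h1 f hf).1,
        hhit (-n) (fun f => (h2 F hF b hb f).2) fun f hf => (h1 f hf).2, hL, sgn_mul, map_neg,
        Finsupp.coe_neg, Pi.neg_apply]
      rcases (hn F hF' b hb ⟨q, hq⟩).lt_or_gt with h | h
      · rw [sgn_of_neg h, if_neg h.not_gt, if_pos (neg_pos.2 h)]; ring
      · rw [sgn_of_pos h, if_pos h, if_neg (by linarith)]; ring
    · have hsum0 : ∑ q ∈ F, (if F.erase q = R then sgn (L q) else 0) = 0 :=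
        Finset.sum_eq_zero fun q hqF => if_neg fun h => hq ⟨q, hqF, h⟩
      rw [hsum0]
      by_cases hneg : ∃ f, b.repr z f < 0
      · obtain ⟨f, hf⟩ := hneg
        filter_upwards [eventually_add_mul_neg hf (b.repr n f),
          eventually_add_mul_neg hf (b.repr (-n) f), hreg] with δ h1 h2 h3
        have e1 : hit F (z + δ • n) = 0 := if_neg fun h =>
          ((exists_hit_iff hFne hb fun f => (h3 F hF b hb f).1).1 h f).not_gt (by rwa [hrep])
        have e2 : hit F (z + δ • -n) = 0 := if_neg fun h =>
          ((exists_hit_iff hFne hb fun f => (h3 F hF b hb f).2).1 h f).not_gt (by rwa [hrep])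
        rw [e1, e2]; simp
      -- A nonnegative `z` with a zero coordinate would, by genericity, make `F` contain the ridge;
      -- so `z` is in the open cone and both rays hit.
      · push Not at hneg
        have hpos : ∀ f, 0 < b.repr z f := fun f => (hneg f).lt_of_ne fun h =>
          hq ⟨f, f.2, hp.eq_erase hF₀ hf₀ hF' hb hneg h.symm⟩
        have hev : ∀ᶠ δ in 𝓝[>] (0 : ℝ), ∀ f,
            0 < b.repr (z + δ • n) f ∧ 0 < b.repr (z + δ • -n) f := by
          simp only [hrep]
          exact eventually_all.2 fun f =>
            (eventually_add_mul_pos (hpos f) _).and (eventually_add_mul_pos (hpos f) _)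
        filter_upwards [hev, hreg] with δ h1 h3
        have e1 : hit F (z + δ • n) = 1 := if_pos
          ((exists_hit_iff hFne hb fun f => (h3 F hF b hb f).1).2 fun f => (h1 f).1)
        have e2 : hit F (z + δ • -n) = 1 := if_pos
          ((exists_hit_iff hFne hb fun f => (h3 F hF b hb f).2).2 fun f => (h1 f).2)
        rw [e1, e2]; simp
  -- Both rays start at `p`, so their signed counts coincide and the total jump is zero.
  obtain ⟨δ, h1, h2⟩ := (hjump.and hreg).exists
  have e1 := hsum (z + δ • n) fun F hF b hb f => (h2 F hF b hb f).1
  have e2 := hsum (z + δ • -n) fun F hF b hb f => (h2 F hF b hb f).2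
  rw [Finset.sum_congr rfl fun F hF => by rw [← h1 F hF]]
  simp only [sub_mul, mul_sub, Finset.sum_sub_distrib, ← mul_assoc, ← Finset.sum_mul]
  rw [e1, e2, sub_self]

end SimplicialPolytope

/-! ### The signed cone over the boundary is a filling. -/

theorem affineIndependent_cons {p : Pt d} {v : Fin d → Pt d}
    (h : LinearIndependent ℝ fun i => v i - p) :
    AffineIndependent ℝ (Fin.cons p v : Fin (d + 1) → Pt d) := by
  rw [affineIndependent_iff_linearIndependent_vsub ℝ _ 0]
  have : (fun i : {x : Fin (d + 1) // x ≠ 0} =>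
      (Fin.cons p v : Fin (d + 1) → Pt d) i -ᵥ (Fin.cons p v : Fin (d + 1) → Pt d) 0) =
      (fun i => v i - p) ∘ fun i : {x : Fin (d + 1) // x ≠ 0} => Fin.pred i.1 i.2 := by
    funext i
    obtain ⟨i, hi⟩ := i
    obtain ⟨j, rfl⟩ := Fin.exists_succ_eq_of_ne_zero hi
    simp
  rw [this]
  exact h.comp _ fun i j hij => Subtype.ext (Fin.pred_inj.1 hij)

/-- The simplex spanned by the origin and the standard basis. -/
noncomputable def cornerSimplex (d : ℕ) : Affine.Simplex ℝ (Pt d) d :=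
  ⟨Fin.cons 0 (EuclideanSpace.basisFun (Fin d) ℝ),
    affineIndependent_cons (by
      simpa only [sub_zero] using
        (EuclideanSpace.basisFun (Fin d) ℝ).orthonormal.linearIndependent)⟩

theorem image_succAbove_eq_erase {α : Type*} [DecidableEq α] {w : Fin (d + 1) → α}
    (hw : Function.Injective w) (i : Fin (d + 1)) :
    Finset.univ.image (fun j => w (i.succAbove j)) = (Finset.univ.image w).erase (w i) := by
  ext x
  simp only [Finset.mem_image, Finset.mem_univ, true_and, Finset.mem_erase]
  constructor
  · rintro ⟨j, rfl⟩
    exact ⟨fun h => Fin.succAbove_ne i j (hw h), _, rfl⟩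
  · rintro ⟨hx, k, rfl⟩
    obtain ⟨j, rfl⟩ := Fin.exists_succAbove_eq fun h : k = i => hx (h ▸ rfl)
    exact ⟨j, rfl⟩

namespace SimplicialPolytope

variable {P : SimplicialPolytope d} {p : Pt d}

theorem exists_coneSimplex [DecidableEq (Pt d)] {F : Finset (Pt d)} (hF : F ∈ P.boundary.facets)
    (hp : p ∉ affineSpan ℝ (F : Set (Pt d))) :
    ∃ s : Affine.Simplex ℝ (Pt d) d, s.points 0 = p ∧
      Finset.univ.image (fun j : Fin d => s.points j.succ) = F := by
  obtain ⟨b, hb⟩ := exists_facetBasis hF hp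
  let e := F.equivFinOfCardEq (P.card_of_facet F hF)
  refine ⟨⟨Fin.cons p fun i => (e.symm i : Pt d), affineIndependent_cons ?_⟩, by simp, ?_⟩
  · have := b.linearIndependent.comp e.symm e.symm.injective
    simpa only [Function.comp_def, hb] using this
  · ext x
    simp only [Fin.cons_succ, Finset.mem_image, Finset.mem_univ, true_and]
    exact ⟨fun ⟨i, hi⟩ => hi ▸ (e.symm i).2, fun hx => ⟨e ⟨x, hx⟩, by simp⟩⟩

open Classical in
variable (P p) in
/-- A choice of a simplex with first vertex `p` whose opposite face is `F`. -/
noncomputable def coneSimplex (F : Finset (Pt d)) : Affine.Simplex ℝ (Pt d) d :=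
  if h : F ∈ P.boundary.facets ∧ p ∉ affineSpan ℝ (F : Set (Pt d)) then
    (exists_coneSimplex h.1 h.2).choose else cornerSimplex d

theorem coneSimplex_points_zero {F : Finset (Pt d)} (hF : F ∈ P.boundary.facets)
    (hp : p ∉ affineSpan ℝ (F : Set (Pt d))) : (P.coneSimplex p F).points 0 = p := by
  classical
  rw [coneSimplex, dif_pos ⟨hF, hp⟩]
  exact (exists_coneSimplex hF hp).choose_spec.1

open Classical in
theorem image_coneSimplex_succ {F : Finset (Pt d)} (hF : F ∈ P.boundary.facets)
    (hp : p ∉ affineSpan ℝ (F : Set (Pt d))) :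
    Finset.univ.image (fun j : Fin d => (P.coneSimplex p F).points j.succ) = F := by
  rw [coneSimplex, dif_pos ⟨hF, hp⟩]
  exact (exists_coneSimplex hF hp).choose_spec.2

open Classical in
theorem image_coneSimplex {F : Finset (Pt d)} (hF : F ∈ P.boundary.facets)
    (hp : p ∉ affineSpan ℝ (F : Set (Pt d))) :
    Finset.univ.image (P.coneSimplex p F).points = insert p F := by
  have h : ∀ w : Fin (d + 1) → Pt d, Finset.univ.image w =
      insert (w 0) (Finset.univ.image fun j : Fin d => w j.succ) := fun w => by
    ext x
    simp only [Finset.mem_image, Finset.mem_univ, true_and, Finset.mem_insert]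
    rw [Fin.exists_fin_succ]
    simp only [eq_comm]
  rw [h, coneSimplex_points_zero hF hp, image_coneSimplex_succ hF hp]

variable (P p) in
/-- The cone over the boundary cycle of a polytope. -/
noncomputable def coneChain : SimplicialChain d :=
  ∑ F ∈ P.finite_facets.toFinset, Finsupp.single (P.coneSimplex p F)
    (P.faceSign F p * sgn (signedVolume (P.coneSimplex p F).points))

theorem coneChain_sum {M : Type*} [AddCommGroup M] (h : Affine.Simplex ℝ (Pt d) d → ℤ → M)
    (h0 : ∀ s, h s 0 = 0) (hadd : ∀ s k l, h s (k + l) = h s k + h s l) :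
    (P.coneChain p).sum h = ∑ F ∈ P.finite_facets.toFinset, h (P.coneSimplex p F)
      (P.faceSign F p * sgn (signedVolume (P.coneSimplex p F).points)) := by
  rw [coneChain, ← Finsupp.sum_finsetSum_index h0 hadd]
  exact Finset.sum_congr rfl fun F _ => Finsupp.sum_single_index (h0 _)

open Classical in
-- The orientation sign put into the cone chain cancels the arbitrary vertex order of each chosen
-- simplex. What remains is the base, seen from `p`, and the side faces, seen from the vertex `q`
-- that they omit.
theorem boundaryCoeff_coneChain (hp : P.IsGenericApex p) (v : Fin d → Pt d) :
    (P.coneChain p).boundaryCoeff v = ∑ F ∈ P.finite_facets.toFinset, P.faceSign F p *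
      ((if Finset.univ.image v = F then sgn (signedVolume (Fin.cons p v)) else 0) +
        ∑ q ∈ F, if Finset.univ.image v = (insert p F).erase q then
          sgn (signedVolume (Fin.cons q v)) else 0) := by
  rw [SimplicialChain.boundaryCoeff, coneChain_sum _ (by simp) (by intros; ring)]
  refine Finset.sum_congr rfl fun F hF => ?_
  rw [Set.Finite.mem_toFinset] at hF
  have hpF := hp.1 F hF
  set s := P.coneSimplex p F
  have hvol : signedVolume s.points ≠ 0 := s.independent.signedVolume_ne_zero
  have hinj : Function.Injective s.points := s.independent.injective
  rw [mul_assoc]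
  congr 1
  have h1 : ∀ i : Fin (d + 1), (-1) ^ (i : ℕ) * (∑ σ : Equiv.Perm (Fin d),
      if (fun j => s.points (i.succAbove (σ j))) = v then (Equiv.Perm.sign σ : ℤ) else 0) =
      sgn (signedVolume s.points) * if Finset.univ.image v = (insert p F).erase (s.points i) then
        sgn (signedVolume (Fin.cons (s.points i) v)) else 0 := by
    intro i
    have h := faceCoeff_eq hvol i v
    rw [image_succAbove_eq_erase hinj, image_coneSimplex hF hpF] at h
    rw [mul_ite, mul_zero, ← h]
  rw [Finset.sum_congr rfl fun i _ => h1 i, ← Finset.mul_sum, ← mul_assoc, sgn_mul_self hvol,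
    one_mul, Fin.sum_univ_succ, coneSimplex_points_zero hF hpF,
    Finset.erase_insert fun h => hpF (subset_affineSpan _ _ h)]
  congr 1
  conv_rhs => rw [← image_coneSimplex_succ hF hpF]
  rw [Finset.sum_image fun a _ c _ hac => Fin.succ_injective _ (hinj hac),
    image_coneSimplex_succ hF hpF]

theorem isFilling_coneChain (hd : 1 ≤ d) (hp : P.IsGenericApex p) :
    P.IsFilling (P.coneChain p) := by
  classical
  intro v
  rw [boundaryCoeff_coneChain hp]
  -- Faces through `p` are side faces and must cancel; faces avoiding `p` can only be bases, which
  -- reproduce the boundary cycle.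
  by_cases hpv : p ∈ Finset.univ.image v
  · have hC : P.cycleCoeff v = 0 := by
      rw [cycleCoeff_def, if_neg]
      exact fun h => hp.1 _ h (subset_affineSpan _ _ hpv)
    obtain ⟨L, hL⟩ := exists_affineMap_signedVolume v
    have hL0 : ∀ y ∈ Finset.univ.image v, L y = 0 := fun y hy => by
      obtain ⟨j, -, hj⟩ := Finset.mem_image.1 hy
      rw [hL]
      exact signedVolume_eq_zero_of_eq (i := 0) (j := j.succ) (by simp [hj])
        (Fin.succ_ne_zero j).symm
    rw [hC]
    refine Eq.trans ?_ (hp.sum_faceSign_ridge hd (R := (Finset.univ.image v).erase p) L (hL0 p hpv)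
      fun r hr => hL0 r (Finset.mem_of_mem_erase hr))
    refine Finset.sum_congr rfl fun F hF => ?_
    rw [Set.Finite.mem_toFinset] at hF
    have hpF : p ∉ F := fun h => hp.1 F hF (subset_affineSpan _ _ h)
    rw [if_neg (by rintro rfl; exact hpF hpv), zero_add]
    congr 1
    refine Finset.sum_congr rfl fun q hq => ?_
    have hqp : q ≠ p := by rintro rfl; exact hpF hq
    rw [hL]
    congr 1
    refine propext ⟨fun h => ?_, fun h => ?_⟩
    · rw [h, Finset.erase_right_comm, Finset.erase_insert hpF]
    · rw [← Finset.insert_erase hpv, ← h, Finset.erase_insert_of_ne hqp.symm]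
  · have h2 : ∀ F, ∑ q ∈ F, (if Finset.univ.image v = (insert p F).erase q then
        sgn (signedVolume (Fin.cons q v)) else 0) =
        if p ∈ F then ∑ q ∈ F, (if Finset.univ.image v = (insert p F).erase q then
        sgn (signedVolume (Fin.cons q v)) else 0) else 0 := fun F => by
      split_ifs with h
      · rfl
      · refine Finset.sum_eq_zero fun q hq => if_neg fun hc => hpv ?_
        rw [hc]
        exact Finset.mem_erase.2 ⟨by rintro rfl; exact h hq, Finset.mem_insert_self _ _⟩
    have h3 : ∀ F ∈ P.finite_facets.toFinset, P.faceSign F p *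
        ((if Finset.univ.image v = F then sgn (signedVolume (Fin.cons p v)) else 0) +
          ∑ q ∈ F, if Finset.univ.image v = (insert p F).erase q then
            sgn (signedVolume (Fin.cons q v)) else 0) =
        if Finset.univ.image v = F then P.cycleCoeff v else 0 := by
      intro F hF
      rw [Set.Finite.mem_toFinset] at hF
      have hpF : p ∉ F := fun h => hp.1 F hF (subset_affineSpan _ _ h)
      rw [h2, if_neg hpF, add_zero, mul_ite, mul_zero]
      split_ifs with h
      · obtain ⟨b, hb⟩ := exists_facetBasis hF (hp.1 F hF)
        exact (cycleCoeff_eq hF hb h).symm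
      · rfl
    rw [Finset.sum_congr rfl h3, Finset.sum_ite_eq]
    split_ifs with h
    · rfl
    · rw [cycleCoeff_def, if_neg]
      simpa using h

end SimplicialPolytope

/-! ### Volume and first moment of a simplex. -/

theorem homogDet_eq (w : Fin (d + 1) → Pt d) : homogDet w = d.factorial * signedVolume w := by
  rw [signedVolume_eq, mul_div_cancel₀ _ (by positivity)]

theorem homogDet_eq_det (w : Fin (d + 1) → Pt d) :
    homogDet w = (Matrix.of fun i j : Fin d => w i.succ j - w 0 j).det := by
  rw [homogDet_eq, signedVolume, mul_div_cancel₀ _ (by positivity)]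

/-- The linear map sending the standard basis to the edges of a simplex at its first vertex. -/
noncomputable def edgeMap (w : Fin (d + 1) → Pt d) : Pt d →ₗ[ℝ] Pt d :=
  (EuclideanSpace.basisFun (Fin d) ℝ).toBasis.constr ℝ fun i => w i.succ - w 0

theorem edgeMap_apply (w : Fin (d + 1) → Pt d) (y : Pt d) :
    edgeMap w y = ∑ i, y i • (w i.succ - w 0) := by
  simp [edgeMap, Module.Basis.constr_apply_fintype]

theorem det_edgeMap (w : Fin (d + 1) → Pt d) : LinearMap.det (edgeMap w) = homogDet w := by
  rw [homogDet_eq_det, ← LinearMap.det_toMatrix (EuclideanSpace.basisFun (Fin d) ℝ).toBasis,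
    ← Matrix.det_transpose]
  congr 1
  ext i j
  simp [LinearMap.toMatrix_apply, edgeMap_apply]

/-- The affine map sending the corner simplex to a given simplex. -/
noncomputable def simplexMap (w : Fin (d + 1) → Pt d) : Pt d →ᵃ[ℝ] Pt d :=
  (edgeMap w).toAffineMap + AffineMap.const ℝ _ (w 0)

theorem simplexMap_apply (w : Fin (d + 1) → Pt d) (y : Pt d) :
    simplexMap w y = edgeMap w y + w 0 := rfl

theorem simplexMap_cornerSimplex (w : Fin (d + 1) → Pt d) (k : Fin (d + 1)) :
    simplexMap w ((cornerSimplex d).points k) = w k := by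
  refine Fin.cases ?_ (fun i => ?_) k
  · simp [cornerSimplex, simplexMap_apply]
  · simp [cornerSimplex, simplexMap_apply, edgeMap_apply]

theorem image_simplexMap (w : Fin (d + 1) → Pt d) :
    simplexMap w '' convexHull ℝ (range (cornerSimplex d).points) = convexHull ℝ (range w) := by
  rw [AffineMap.image_convexHull, ← range_comp]
  congr 2
  exact funext (simplexMap_cornerSimplex w)

theorem isCompact_convexHull_range (w : Fin (d + 1) → Pt d) :
    IsCompact (convexHull ℝ (range w)) := (finite_range w).isCompact_convexHull ℝ

theorem setIntegral_simplex {E : Type*} [NormedAddCommGroup E] [NormedSpace ℝ E]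
    {w : Fin (d + 1) → Pt d} (hw : AffineIndependent ℝ w) (g : Pt d → E) :
    ∫ x in convexHull ℝ (range w), g x =
      |homogDet w| • ∫ y in convexHull ℝ (range (cornerSimplex d).points), g (simplexMap w y) := by
  have hdet : homogDet w ≠ 0 := by
    rw [homogDet_eq]
    exact mul_ne_zero (by positivity) hw.signedVolume_ne_zero
  have hinj : Function.Injective (simplexMap w) := by
    have : IsUnit (edgeMap w) := by
      rw [LinearMap.isUnit_iff_isUnit_det, det_edgeMap]
      exact hdet.isUnit
    intro a b hab
    simp only [simplexMap_apply, add_left_inj] at hab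
    exact ((Module.End.isUnit_iff _).1 this).1 hab
  have hderiv : ∀ x, HasFDerivAt (simplexMap w) (LinearMap.toContinuousLinearMap (edgeMap w)) x :=
    fun x => ((LinearMap.toContinuousLinearMap (edgeMap w)).hasFDerivAt).add_const (w 0)
  rw [← image_simplexMap, integral_image_eq_integral_abs_det_fderiv_smul volume
    (isCompact_convexHull_range _).isClosed.measurableSet
    (fun x _ => (hderiv x).hasFDerivWithinAt) hinj.injOn, integral_smul]
  congr 2
  rw [← det_edgeMap]
  rfl

theorem homogDet_cornerSimplex (d : ℕ) : homogDet (cornerSimplex d).points = 1 := by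
  rw [homogDet_eq_det, ← Matrix.det_one (n := Fin d)]
  congr 1
  ext i j
  simp [cornerSimplex, Matrix.one_apply, eq_comm]

/-- Barycentric coordinates with respect to the corner simplex. -/
noncomputable def cornerCoord (k : Fin (d + 1)) (y : Pt d) : ℝ :=
  Fin.cases (1 - ∑ i, y i) (fun i => y i) k

theorem continuous_cornerCoord (k : Fin (d + 1)) : Continuous (cornerCoord (d := d) k) := by
  refine Fin.cases ?_ (fun i => ?_) k
  · change Continuous fun y : Pt d => 1 - ∑ i, y i
    fun_prop
  · change Continuous fun y : Pt d => y i
    fun_prop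

theorem simplexMap_eq_sum (w : Fin (d + 1) → Pt d) (y : Pt d) :
    simplexMap w y = ∑ k, cornerCoord k y • w k := by
  rw [simplexMap_apply, edgeMap_apply, Fin.sum_univ_succ]
  simp only [cornerCoord, Fin.cases_zero, Fin.cases_succ, smul_sub, Finset.sum_sub_distrib,
    ← Finset.sum_smul, sub_smul, one_smul]
  abel

/-- The volume of the corner simplex. -/
noncomputable def cornerVolume (d : ℕ) : ℝ :=
  volume.real (convexHull ℝ (range (cornerSimplex d).points))

theorem volume_simplex {w : Fin (d + 1) → Pt d} (hw : AffineIndependent ℝ w) :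
    volume.real (convexHull ℝ (range w)) = cornerVolume d * |homogDet w| := by
  have h := setIntegral_simplex hw fun _ => (1 : ℝ)
  rw [setIntegral_const, setIntegral_const] at h
  simpa [cornerVolume, mul_comm] using h

theorem setIntegral_simplex_id {w : Fin (d + 1) → Pt d} (hw : AffineIndependent ℝ w) :
    ∫ x in convexHull ℝ (range w), x = |homogDet w| •
      ∑ k, (∫ y in convexHull ℝ (range (cornerSimplex d).points), cornerCoord k y) • w k := by
  rw [setIntegral_simplex hw]
  simp only [simplexMap_eq_sum]
  rw [integral_finsetSum]
  · simp only [integral_smul_const]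
  · intro k _
    exact (((continuous_cornerCoord k).smul continuous_const).continuousOn).integrableOn_compact
      (isCompact_convexHull_range _)

/-- Symmetry makes the barycentric coordinates have equal integrals, and they sum to one. The volume
of the corner simplex is never evaluated: it is a common factor of all volumes and moments and
cancels in the end. -/
theorem integral_cornerCoord (k : Fin (d + 1)) :
    ∫ y in convexHull ℝ (range (cornerSimplex d).points), cornerCoord k y =
      cornerVolume d / (d + 1) := by
  set e := (cornerSimplex d).points
  set m : Fin (d + 1) → ℝ := fun k => ∫ y in convexHull ℝ (range e), cornerCoord k y
  have he : AffineIndependent ℝ e := (cornerSimplex d).independent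
  have hsucc : ∀ i : Fin d, m i.succ = m 0 := by
    intro i
    -- Exchanging two vertices changes neither the hull nor the absolute determinant. Comparing the
    -- `i`-th coordinates of the two resulting moment formulas equates two of the integrals.
    let σ : Equiv.Perm (Fin (d + 1)) := Equiv.swap 0 i.succ
    have h1 := setIntegral_simplex_id he
    have h2 := setIntegral_simplex_id (w := e ∘ σ)
      (he.comp_embedding σ.toEmbedding)
    rw [σ.surjective.range_comp, homogDet_perm, Equiv.Perm.sign_swap (Fin.succ_ne_zero i).symm,
      homogDet_cornerSimplex, h1, homogDet_cornerSimplex] at h2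
    have h3 := congrArg (fun x : Pt d => x i) h2
    have hcoord : ∀ w : Fin (d + 1) → Pt d, (∑ k, m k • w k) i = ∑ k, m k * w k i := fun w => by
      simp
    have hei : ∀ k, e k i = if k = i.succ then 1 else 0 := fun k => by
      refine Fin.cases ?_ (fun l => ?_) k
      · simp [e, cornerSimplex, (Fin.succ_ne_zero i).symm]
      · simp [e, cornerSimplex, eq_comm]
    simp only [abs_one, one_smul, Units.val_neg, Units.val_one, Int.cast_neg, Int.cast_one,
      mul_one, abs_neg] at h3
    rw [hcoord, hcoord] at h3
    simp only [hei, Function.comp_apply] at h3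
    have hσ : ∀ k, σ k = i.succ ↔ k = 0 := fun k => by
      rw [← Equiv.swap_apply_left 0 i.succ]
      exact σ.injective.eq_iff
    simpa [hσ] using h3
  have hall : ∀ k, m k = m 0 := fun k => Fin.cases rfl hsucc k
  have hsum : ∑ k, m k = cornerVolume d := by
    simp only [m]
    rw [← integral_finsetSum]
    · have : ∀ y : Pt d, ∑ k, cornerCoord k y = 1 := fun y => by
        rw [Fin.sum_univ_succ]; simp [cornerCoord]
      simp only [this]
      rw [setIntegral_const]
      simp [cornerVolume, e]
    · intro k _
      exact ((continuous_cornerCoord k).continuousOn).integrableOn_compact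
        (isCompact_convexHull_range _)
  rw [Finset.sum_congr rfl fun k _ => hall k] at hsum
  simp only [Finset.sum_const, Finset.card_univ, Fintype.card_fin, nsmul_eq_mul] at hsum
  change m k = _
  rw [hall, ← hsum]
  push_cast
  field_simp

theorem centroid_simplex {w : Fin (d + 1) → Pt d} (hw : AffineIndependent ℝ w) :
    ∫ x in convexHull ℝ (range w), x =
      (cornerVolume d / (d + 1) * |homogDet w|) • ∑ k, w k := by
  rw [setIntegral_simplex_id hw]
  simp only [integral_cornerCoord, ← Finset.smul_sum]
  rw [smul_smul, mul_comm]

/-! ### Integration over the polytope by signed cones. -/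

theorem exists_ge_one_iff_mem_convexHull_insert {F : Finset (Pt d)} {p x : Pt d} (hF : F.Nonempty)
    (hx : x ≠ p) :
    (∃ r ≥ (1 : ℝ), p + r • (x - p) ∈ convexHull ℝ (F : Set (Pt d))) ↔
      x ∈ convexHull ℝ (insert p (F : Set (Pt d))) := by
  rw [convexHull_insert (Finset.coe_nonempty.2 hF)]
  simp only [convexJoin_singleton_left, mem_iUnion, exists_prop, segment_eq_image_lineMap]
  constructor
  · rintro ⟨r, hr, hrF⟩
    refine ⟨_, hrF, r⁻¹, ⟨by positivity, inv_le_one_of_one_le₀ hr⟩, ?_⟩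
    have : r ≠ 0 := by positivity
    rw [AffineMap.lineMap_apply_module', add_sub_cancel_left, smul_smul, inv_mul_cancel₀ this,
      one_smul, sub_add_cancel]
  · rintro ⟨y, hy, t, ⟨ht0, ht1⟩, rfl⟩
    have ht : 0 < t := ht0.lt_of_ne fun h => hx (by rw [← h, AffineMap.lineMap_apply_zero])
    refine ⟨t⁻¹, (one_le_inv₀ ht).2 ht1, ?_⟩
    rw [AffineMap.lineMap_apply_module', add_sub_cancel_right, smul_smul, inv_mul_cancel₀ ht.ne',
      one_smul, add_sub_cancel]
    exact hy

namespace SimplicialPolytope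

variable {P : SimplicialPolytope d} {p : Pt d}

open Classical in
-- The ray from `p` through `x` is evaluated at parameter `1`: a facet is hit at or beyond `x`
-- exactly when `x` is in its cone. The exceptional `x` lie in finitely many proper affine
-- subspaces.
theorem ae_sum_faceSign_mem (hd : 1 ≤ d) (hp : P.IsGenericApex p) :
    ∀ᵐ x : Pt d, ∑ F ∈ P.finite_facets.toFinset, P.faceSign F p *
      (if x ∈ convexHull ℝ (insert p (F : Set (Pt d))) then 1 else 0) =
      if x ∈ P.carrier then 1 else 0 := by
  let S : Set (Finset (Pt d)) := ({{p}} ∪ P.boundary.facets) ∪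
    ⋃ F ∈ P.boundary.facets, (fun f => insert p (F.erase f)) '' F
  have hS : S.Finite := ((finite_singleton _).union P.finite_facets).union
    (P.finite_facets.biUnion fun F _ => F.finite_toSet.image _)
  have hcard : ∀ s ∈ S, s.card ≤ d := by
    rintro s ((hs | hs) | hs)
    · rw [mem_singleton_iff.1 hs]; simpa using hd
    · exact (P.card_of_facet s hs).le
    · simp only [mem_iUnion] at hs
      obtain ⟨F, hF, f, hf, rfl⟩ := hs
      refine (Finset.card_insert_le _ _).trans ?_
      rw [Finset.card_erase_of_mem hf, P.card_of_facet _ hF]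
      omega
  filter_upwards [ae_notMem_affineSpan hS hcard] with x hx
  have hxp : x ≠ p := by
    rintro rfl
    exact hx {x} (Or.inl (Or.inl rfl)) (subset_affineSpan _ _ (by simp))
  have h := sum_faceSign_hit (P := P) (p := p) (u := x - p) (t₀ := 1) hp.1 (sub_ne_zero.2 hxp)
    ?_ zero_le_one ?_
  · rw [one_smul, add_sub_cancel] at h
    rw [← h]
    refine Finset.sum_congr rfl fun F hF => ?_
    rw [Set.Finite.mem_toFinset] at hF
    rw [exists_ge_one_iff_mem_convexHull_insert (P.boundary.nonempty_of_mem_faces hF.1) hxp]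
  · intro F hF f hf t ht
    refine hx (insert p (F.erase f)) (Or.inr (mem_biUnion hF ⟨f, hf, rfl⟩)) ?_
    have ht0 : t ≠ 0 := by
      rintro rfl
      rw [zero_smul, add_zero] at ht
      exact hp.1 F hF (convexHull_subset_affineSpan _
        (convexHull_mono (Finset.coe_subset.2 (Finset.erase_subset _ _)) ht))
    have h1 : p ∈ affineSpan ℝ ((insert p (F.erase f) : Finset (Pt d)) : Set (Pt d)) :=
      subset_affineSpan _ _ (by simp)
    have h2 := AffineMap.lineMap_mem t⁻¹ h1 (affineSpan_mono _
      (Finset.coe_subset.2 (Finset.subset_insert _ _)) (convexHull_subset_affineSpan _ ht))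
    rwa [AffineMap.lineMap_apply_module', add_sub_cancel_left, smul_smul, inv_mul_cancel₀ ht0,
      one_smul, sub_add_cancel] at h2
  · rw [one_smul, add_sub_cancel, frontier_eq]
    simp only [mem_iUnion, not_exists]
    exact fun F hF h => hx F (Or.inl (Or.inr hF)) (convexHull_subset_affineSpan _ h)

theorem setIntegral_carrier {E : Type*} [NormedAddCommGroup E] [NormedSpace ℝ E] (hd : 1 ≤ d)
    (hp : P.IsGenericApex p) {g : Pt d → E} (hg : Continuous g) :
    ∫ x in P.carrier, g x = ∑ F ∈ P.finite_facets.toFinset, (P.faceSign F p : ℝ) •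
      ∫ x in convexHull ℝ (insert p (F : Set (Pt d))), g x := by
  classical
  have hcomp : ∀ F : Finset (Pt d), IsCompact (convexHull ℝ (insert p (F : Set (Pt d)))) :=
    fun F => (F.finite_toSet.insert p).isCompact_convexHull ℝ
  have hmeas := fun F => (hcomp F).isClosed.measurableSet
  rw [← integral_indicator P.isClosed_carrier.measurableSet]
  simp_rw [← integral_indicator (hmeas _), ← integral_smul]
  rw [← integral_finsetSum]
  · refine integral_congr_ae ?_
    filter_upwards [ae_sum_faceSign_mem hd hp] with x hx
    have hx' : ∑ F ∈ P.finite_facets.toFinset, (P.faceSign F p : ℝ) *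
        (if x ∈ convexHull ℝ (insert p (F : Set (Pt d))) then 1 else 0) =
        if x ∈ P.carrier then 1 else 0 := by exact_mod_cast hx
    calc P.carrier.indicator g x = (if x ∈ P.carrier then (1 : ℝ) else 0) • g x := by
          simp [indicator_apply]
      _ = _ := by
          rw [← hx', Finset.sum_smul]
          refine Finset.sum_congr rfl fun F _ => ?_
          rw [mul_smul, indicator_apply]
          simp
  · intro F _
    exact ((integrable_indicator_iff (hmeas F)).2
      (hg.continuousOn.integrableOn_compact (hcomp F))).smul _

theorem range_coneSimplex {F : Finset (Pt d)} (hF : F ∈ P.boundary.facets)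
    (hp : p ∉ affineSpan ℝ (F : Set (Pt d))) :
    range (P.coneSimplex p F).points = insert p (F : Set (Pt d)) := by
  classical
  have := congrArg (fun s : Finset (Pt d) => (s : Set (Pt d))) (image_coneSimplex hF hp)
  simpa using this

theorem sgn_signedVolume_mul_homogDet (w : Fin (d + 1) → Pt d) :
    (sgn (signedVolume w) : ℝ) * homogDet w = |homogDet w| := by
  rw [homogDet_eq, abs_mul, ← sgn_mul_eq_abs (signedVolume w), abs_of_nonneg (by positivity)]
  ring

theorem volume_carrier (hd : 1 ≤ d) (hp : P.IsGenericApex p) :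
    volume.real P.carrier =
      cornerVolume d * (P.coneChain p).sum fun s k => (k : ℝ) * homogDet s.points := by
  have h := setIntegral_carrier hd hp (continuous_const (y := (1 : ℝ)))
  rw [setIntegral_const, smul_eq_mul, mul_one] at h
  rw [h, coneChain_sum _ (by simp) (by intros; push_cast; ring), Finset.mul_sum]
  refine Finset.sum_congr rfl fun F hF => ?_
  rw [Set.Finite.mem_toFinset] at hF
  rw [← range_coneSimplex hF (hp.1 F hF), setIntegral_const,
    volume_simplex (P.coneSimplex p F).independent, ← sgn_signedVolume_mul_homogDet]
  push_cast
  simp only [smul_eq_mul]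
  ring

theorem setIntegral_carrier_apply (hd : 1 ≤ d) (hp : P.IsGenericApex p) (j : Fin d) :
    (∫ x in P.carrier, x) j = cornerVolume d / (d + 1) *
      (P.coneChain p).sum fun s k => (k : ℝ) * (homogDet s.points * ∑ a, s.points a j) := by
  have h := setIntegral_carrier hd hp continuous_id
  simp only [id] at h
  rw [h, coneChain_sum _ (by simp) (by intros; push_cast; ring), Finset.mul_sum]
  rw [WithLp.ofLp_sum, Finset.sum_apply]
  refine Finset.sum_congr rfl fun F hF => ?_
  rw [Set.Finite.mem_toFinset] at hF
  rw [← range_coneSimplex hF (hp.1 F hF), centroid_simplex (P.coneSimplex p F).independent,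
    ← sgn_signedVolume_mul_homogDet]
  simp
  ring

end SimplicialPolytope

/-! ### Comparison of the two centers. -/

theorem SimplicialChain.volume_eq {d : ℕ} (K : SimplicialChain d) :
    K.volume = (K.sum fun s k => (k : ℝ) * homogDet s.points) / d.factorial := by
  rw [volume, Finsupp.sum, Finsupp.sum, Finset.sum_div]
  exact Finset.sum_congr rfl fun s _ => by rw [signedVolume_eq, mul_div_assoc]

theorem SimplicialPolytope.IsFilling.pairSqSum_eq {d : ℕ} {P : SimplicialPolytope d} {c : ℝ}
    (hc : ∀ t ∈ P.boundary.facets, edgeSqSum t = c) {K : SimplicialChain d} (hK : P.IsFilling K)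
    {v : Fin d → Pt d} (hv : K.boundaryCoeff v ≠ 0) : pairSqSum v = c := by
  classical
  rw [hK v, SimplicialPolytope.cycleCoeff_def] at hv
  have hF : Finset.univ.image v ∈ P.boundary.facets := by
    by_contra h
    exact hv (if_neg h)
  have hinj : Function.Injective v := by
    have h := Finset.card_image_iff.1 ((P.card_of_facet _ hF).trans (Finset.card_fin d).symm)
    simpa using h
  rw [← edgeSqSum_image hinj, hc _ hF]

theorem mainTheorem5 (d : ℕ) (hd : 1 ≤ d) (P : SimplicialPolytope d) (c : ℝ)
    (hc : ∀ t ∈ P.boundary.facets, edgeSqSum t = c) :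
    P.IsCircumcenterOfMass P.centroid := by
  obtain ⟨p, hp⟩ := SimplicialPolytope.exists_isGenericApex hd P
  have hfill := SimplicialPolytope.isFilling_coneChain hd hp
  refine ⟨⟨_, hfill⟩, fun K hK => ?_⟩
  have hbd : ∀ v, K.boundaryCoeff v = (P.coneChain p).boundaryCoeff v := fun v =>
    (hK v).trans (hfill v).symm
  have hvol := SimplicialPolytope.volume_carrier hd hp
  rw [← SimplicialChain.sum_homogDet_eq hbd] at hvol
  have hpos : 0 < MeasureTheory.volume.real P.carrier := by
    have hint : (interior P.carrier).Nonempty := by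
      rw [← closure_nonempty_iff, P.closure_interior]
      exact P.nonempty
    exact ENNReal.toReal_pos ((isOpen_interior.measure_pos _ hint).trans_le
      (measure_mono interior_subset)).ne' P.isCompact.measure_lt_top.ne
  set H := K.sum fun s k => (k : ℝ) * homogDet s.points with hH
  have hκ : cornerVolume d ≠ 0 := fun h => by rw [hvol, h, zero_mul] at hpos; exact hpos.false
  have hH0 : H ≠ 0 := fun h => by rw [hvol, h, mul_zero] at hpos; exact hpos.false
  have hKvol : K.volume = H / d.factorial := K.volume_eq
  refine ⟨by rw [hKvol]; positivity, ?_⟩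
  ext j
  have hmoment := SimplicialPolytope.setIntegral_carrier_apply hd hp j
  -- The moment of the solid passes from the cone to `K` because they have equal boundary, and then
  -- from vertex sums to circumcenters by the edge condition.
  rw [← SimplicialChain.sum_homogDet_mul_sum_eq hbd j,
    ← SimplicialChain.sum_circumcenter_eq (fun v => hK.pairSqSum_eq hc) j] at hmoment
  have hcent : P.centroid j = (cornerVolume d * H)⁻¹ * (∫ x in P.carrier, x) j := by
    rw [SimplicialPolytope.centroid, setAverage_eq, hvol]
    simp
  have hcm : K.circumcenterOfMass j = (H / d.factorial)⁻¹ *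
      ((K.sum fun s k => (k : ℝ) * homogDet s.points * ((d + 1) * s.circumcenter j)) /
        ((d + 1) * d.factorial)) := by
    rw [SimplicialChain.circumcenterOfMass, hKvol, Finsupp.sum, Finsupp.sum, Finset.sum_div]
    simp only [PiLp.smul_apply, smul_eq_mul, WithLp.ofLp_sum, Finset.sum_apply]
    congr 1
    refine Finset.sum_congr rfl fun s _ => ?_
    rw [signedVolume_eq]
    field_simp
  rw [hcm, hcent, hmoment]
  generalize (K.sum fun s k => (k : ℝ) * homogDet s.points * ((d + 1) * s.circumcenter j)) = M
  field_simp
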